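/- Work over $\mathbb C$. Let $S\subset\mathbb N$ be a numerical semigroup with $g:=\#(\mathbb N\setminus S)>0$ and conductor $c$ (the least integer such that every $r\ge c$ lies in $S$), let $\rho(s):=\#\{r>s: r\notin S\}$, and let $0=k_0<k_1<\dots<k_n$ be integers, $\mathbf k=(k_0,\dots,k_n)$. Let $d\ge\max(n,2g-2)$. Let $M^n_d$ be the space of nondegenerate degree-$d$ morphisms $f:\mathbb P^1\to\mathbb P^n$, each identified with the coefficients of its $n+1$ parameterizing binary forms of degree $d$ (so $M^n_d$ is an open subset of $\mathbb A^{(n+1)(d+1)}$). Let $\mathcal V_{\mathbf k}\subset M^n_d$ be the set of those $f$ for which $f$ is injective and there is a point $P\in\mathbb P^1$ such that the image is smooth away from $f(P)$, the value semigroup at $f(P)$ (the set of valuations in a local parameter $t$ at $P$ of nonzero elements of the image of $\mathbb C[[x_1,\dots,x_n]]$ under $x_i\mapsto f_i(t)$, where the $f_i$ are the pullbacks of affine coordinates centred at $f(P)$) equals $S$, and the vanishing orders at $P$ of the nonzero linear combinations of the parameterizing forms are exactly $k_0,\dots,k_n$. A decomposition of $s\in\mathbb N$ is a vector $(m_1,\dots,m_n)\in\mathbb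 N^n$ with $s=m_1k_1+\dots+m_nk_n$. It is reducible if some proper sub-sum of the right-hand side has another decomposition with respect to $k_1,\dots,k_n$, and irreducible otherwise. For each $s$ let $I(s)$ be the set of irreducible decompositions of $s$. (The theorem also holds if, for every $s$, $I(s)$ is instead any set of decompositions of $s$ containing exactly one from each class of the equivalence relation generated by replacing a proper sub-sum of a decomposition by another decomposition of the same number.) Put $\psi(s)=\#I(s)$, $\varphi(s)=\max(\psi(s)-1,0)$, and for each $s$ with $I(s)\ne\emptyset$ fix any $v_{s,1}\in I(s)$. Let $E\subset\mathbb Q^n$ be the finite set of all differences $v-v_{s,1}$, where $s\in S$, $0<s<c$, and $v\in I(s)\setminus\{v_{s,1}\}$. Let $C_1,\dots,C_q$ be the circuits (minimal linearly dependent subsets) of the vector matroid on $E$, and let $s(i)$ be the largest $s\in S$ with $0<s<c$ such that $C_i$ contains a difference $v-v_{s,1}$ with $v\in I(s)\setminus\{v_{s,1}\}$. Put $D(\mathbf k)=\sum_{i=1}^q\rho(s(i))$. Let $s_1^*<\dots<s_\ell^*$ be the minimal generators of $S$ that are less than $c$ and are not entries of $\mathbf k$, and let $m=\min\bigl(\ell,\sum_{s\in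 S}\varphi(s)\bigr)$. **Theorem.** If $\mathcal V_{\mathbf k}$ is nonempty, then $$\operatorname{cod}(\mathcal V_{\mathbf k},M^n_d)\ \ge\ \sum_{i=1}^n(k_i-i)+\sum_{s\in S,\ 1\le s\le 2g}\varphi(s)\rho(s)-\sum_{i=1}^m\rho(s_i^*)-D(\mathbf k)-1,$$ where the codimension is that of the Zariski closure (the minimum over its irreducible components). -/

import Mathlib

open scoped Classical PowerSeries

noncomputable section

namespace Severi

/-! ### Numerical semigroups -/

/-- The number of gaps of `S`. -/
def genus (S : AddSubmonoid ℕ) : ℕ := {r : ℕ | r ∉ S}.ncard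

/-- The conductor: the least `c` such that every integer `≥ c` lies in `S`. -/
def conductor (S : AddSubmonoid ℕ) : ℕ := sInf {c : ℕ | ∀ r, c ≤ r → r ∈ S}

/-- `ρ(s)` is the number of gaps of `S` greater than `s`. -/
def rho (S : AddSubmonoid ℕ) (s : ℕ) : ℕ := {r : ℕ | s < r ∧ r ∉ S}.ncard

/-- Minimal generators of `S`: nonzero elements that are not sums of two nonzero elements. -/
def IsMinimalGenerator (S : AddSubmonoid ℕ) (s : ℕ) : Prop :=
  s ∈ S ∧ s ≠ 0 ∧ ∀ a ∈ S, ∀ b ∈ S, a + b = s → a = 0 ∨ b = 0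

section Curves

variable {n d : ℕ}

/-! ### Morphisms from the projective line

A tuple of `n + 1` binary forms of degree `d` is given by its coefficients
`a (i, j)`, `i ≤ n`, `j ≤ d`; points of the projective line are given by nonzero vectors of `ℂ²`. -/

/-- The value at `(u, v)` of the `i`-th form `∑ j, a (i, j) u ^ j v ^ (d - j)`. -/
def evalForm {A : Type} [CommRing A] [Algebra ℂ A] (a : Fin (n + 1) × Fin (d + 1) → ℂ)
    (i : Fin (n + 1)) (u v : A) : A :=
  ∑ j : Fin (d + 1), algebraMap ℂ A (a (i, j)) * u ^ (j : ℕ) * v ^ (d - (j : ℕ))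

/-- Two vectors of `ℂ²` that are linearly independent (for nonzero vectors: distinct points of the
projective line). -/
def Indep (P Q : Fin 2 → ℂ) : Prop := P 0 * Q 1 - P 1 * Q 0 ≠ 0

/-- `M^n_d`: coefficients of `n + 1` linearly independent binary forms of degree `d` without
common zero, i.e. of the nondegenerate morphisms `ℙ¹ → ℙⁿ` of degree `d`. -/
def mappingSpace (n d : ℕ) : Set (Fin (n + 1) × Fin (d + 1) → ℂ) :=
  {a | LinearIndependent ℂ (fun (i : Fin (n + 1)) (j : Fin (d + 1)) => a (i, j)) ∧
    ∀ P : Fin 2 → ℂ, P ≠ 0 → ∃ i, evalForm a i (P 0) (P 1) ≠ 0}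

/-- Injectivity of the morphism on points: if the image vectors of `P` and `Q` are proportional,
then so are `P` and `Q`. -/
def InjectiveOnPoints (a : Fin (n + 1) × Fin (d + 1) → ℂ) : Prop :=
  ∀ P Q : Fin 2 → ℂ, Indep P Q →
    ∃ i j, evalForm a i (P 0) (P 1) * evalForm a j (Q 0) (Q 1) ≠
      evalForm a j (P 0) (P 1) * evalForm a i (Q 0) (Q 1)

/-- The `i`-th form along `t ↦ P + t Q`; if `Q` is independent of `P`, then `t` is a
local parameter of the projective line at `P`. -/
def localSection (a : Fin (n + 1) × Fin (d + 1) → ℂ) (P Q : Fin 2 → ℂ) (i : Fin (n + 1)) : ℂ⟦X⟧ :=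
  evalForm a i (PowerSeries.C (P 0) + PowerSeries.C (Q 0) * PowerSeries.X)
    (PowerSeries.C (P 1) + PowerSeries.C (Q 1) * PowerSeries.X)

/-- The pullbacks `F_i / F_j - (F_i / F_j)(P)` of the affine coordinates of `ℙⁿ` centred at the
image of `P`, in the chart where the `j`-th coordinate is nonzero (it is `0` for `i = j`). -/
def localCoordinate (a : Fin (n + 1) × Fin (d + 1) → ℂ) (P Q : Fin 2 → ℂ) (j i : Fin (n + 1)) :
    ℂ⟦X⟧ :=
  localSection a P Q i * (localSection a P Q j)⁻¹ -
    PowerSeries.C (PowerSeries.constantCoeff (localSection a P Q i * (localSection a P Q j)⁻¹))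

/-- The set of `t`-adic valuations of the nonzero elements of the image of the ring of formal
power series in the affine coordinates at the image of `P`, under substitution of their pullbacks.
It does not depend on the chart `j` nor on the local parameter (given by `Q`). -/
def valueSet (a : Fin (n + 1) × Fin (d + 1) → ℂ) (P : Fin 2 → ℂ) : Set ℕ :=
  {s | ∃ (Q : Fin 2 → ℂ) (j : Fin (n + 1)) (G : MvPowerSeries (Fin (n + 1)) ℂ),
    Indep P Q ∧ evalForm a j (P 0) (P 1) ≠ 0 ∧
    PowerSeries.order (MvPowerSeries.subst (localCoordinate a P Q j) G : ℂ⟦X⟧) = (s : ℕ∞)}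

/-- The set of vanishing orders at `P` of the nonzero linear combinations of the forms. -/
def vanishingOrders (a : Fin (n + 1) × Fin (d + 1) → ℂ) (P : Fin 2 → ℂ) : Set ℕ :=
  {s | ∃ (Q : Fin 2 → ℂ) (c : Fin (n + 1) → ℂ), Indep P Q ∧
    PowerSeries.order (∑ i, c i • localSection a P Q i) = (s : ℕ∞)}

/-- The stratum `V_k`: morphisms that are injective on points (every point of the image is
unibranch), with value semigroup `S` and vanishing orders `k 0 < ⋯ < k n` at one point `P`, the
image being smooth (value semigroup `ℕ`) at the images of all other points. -/
def stratum (d : ℕ) (S : AddSubmonoid ℕ) (k : Fin (n + 1) → ℕ) :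
    Set (Fin (n + 1) × Fin (d + 1) → ℂ) :=
  {a | a ∈ mappingSpace n d ∧ InjectiveOnPoints a ∧
    ∃ P : Fin 2 → ℂ, P ≠ 0 ∧ valueSet a P = (S : Set ℕ) ∧ vanishingOrders a P = Set.range k ∧
      ∀ R : Fin 2 → ℂ, Indep P R → valueSet a R = Set.univ}

/-- The codimension of (the Zariski closure of) a subset of an affine space: the height of its
vanishing ideal, i.e. the least codimension of an irreducible component of the closure.
As `mappingSpace n d` is Zariski open in affine space, this is the codimension in it of a
nonempty subset of it. -/
def codim {σ : Type} (Z : Set (σ → ℂ)) : ℕ∞ := (MvPolynomial.vanishingIdeal ℂ Z).height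

end Curves

section Decompositions

variable {n : ℕ}

/-! ### Decompositions

Here `k 0 = 0` and the parts are `k 1 < ⋯ < k n`; exponent vectors `v : Fin n → ℕ` are indexed so
that `v i` is the multiplicity of the part `k i.succ`. -/

/-- The sum `∑ m_i k_i`. -/
def value (k : Fin (n + 1) → ℕ) (v : Fin n → ℕ) : ℕ := ∑ i, v i * k i.succ

/-- The decompositions of `s` (when the parts are positive, all multiplicities are `≤ s`). -/
def decompositions (k : Fin (n + 1) → ℕ) (s : ℕ) : Finset (Fin n → ℕ) :=
  (Fintype.piFinset fun _ => Finset.range (s + 1)).filter fun v => value k v = s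

/-- `w` arises from `v` by replacing a proper sub-sum `u` of `v` by a decomposition `u'` of the
same number. -/
def Trade (k : Fin (n + 1) → ℕ) (v w : Fin n → ℕ) : Prop :=
  ∃ u u' r : Fin n → ℕ, r ≠ 0 ∧ v = u + r ∧ w = u' + r ∧ value k u = value k u'

/-- A decomposition is reducible if some proper sub-sum of it decomposes in another way. -/
def Reducible (k : Fin (n + 1) → ℕ) (v : Fin n → ℕ) : Prop :=
  ∃ u u' r : Fin n → ℕ, r ≠ 0 ∧ v = u + r ∧ u' ≠ u ∧ value k u = value k u'

/-- The irreducible decompositions of `s`. -/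
def irreducibleDecompositions (k : Fin (n + 1) → ℕ) (s : ℕ) : Finset (Fin n → ℕ) :=
  (decompositions k s).filter fun v => ¬ Reducible k v

/-- `I s` contains exactly one decomposition of `s` from each class of decompositions that can
be transformed into each other by successive replacements of proper sub-sums. -/
def IsSystemOfRepresentatives (k : Fin (n + 1) → ℕ) (I : ℕ → Finset (Fin n → ℕ)) : Prop :=
  ∀ s, I s ⊆ decompositions k s ∧
    ∀ v ∈ decompositions k s, ∃! w, w ∈ I s ∧ Relation.ReflTransGen (Trade k) v w

/-! ### The expected codimension

`I s` is the set of decompositions of `s` that are counted and `ref s ∈ I s` is the reference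
decomposition of `s`. -/

/-- `φ(s) = max(ψ(s) - 1, 0)`, where `ψ(s)` is the number of elements of `I s`. -/
def phi (I : ℕ → Finset (Fin n → ℕ)) (s : ℕ) : ℕ := (I s).card - 1

/-- The difference of two exponent vectors. -/
def diff (v w : Fin n → ℕ) : Fin n → ℚ := fun i => (v i : ℚ) - (w i : ℚ)

/-- The differences `v - ref s` for `v ∈ I s`, `v ≠ ref s`. -/
def columnVectors (I : ℕ → Finset (Fin n → ℕ)) (ref : ℕ → Fin n → ℕ) (s : ℕ) :
    Finset (Fin n → ℚ) :=
  ((I s).erase (ref s)).image fun v => diff v (ref s)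

/-- The nonzero elements of `S` less than the conductor. -/
def smallElements (S : AddSubmonoid ℕ) : Finset ℕ :=
  (Finset.range (conductor S)).filter fun s => s ∈ S ∧ s ≠ 0

/-- The ground set `E` of the vector matroid. -/
def groundSet (S : AddSubmonoid ℕ) (I : ℕ → Finset (Fin n → ℕ)) (ref : ℕ → Fin n → ℕ) :
    Finset (Fin n → ℚ) :=
  (smallElements S).biUnion (columnVectors I ref)

/-- The circuits of the vector matroid on `E`: the minimal linearly dependent subsets of `E`. -/
def circuits (S : AddSubmonoid ℕ) (I : ℕ → Finset (Fin n → ℕ)) (ref : ℕ → Fin n → ℕ) :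
    Finset (Finset (Fin n → ℚ)) :=
  (groundSet S I ref).powerset.filter fun C =>
    ¬ LinearIndepOn ℚ id (C : Set (Fin n → ℚ)) ∧
      ∀ C' : Finset (Fin n → ℚ), C' ⊂ C → LinearIndepOn ℚ id (C' : Set (Fin n → ℚ))

/-- The largest `s` among the nonzero elements of `S` below the conductor for which `C` contains
one of the differences attached to `s`. -/
def topElement (S : AddSubmonoid ℕ) (I : ℕ → Finset (Fin n → ℕ)) (ref : ℕ → Fin n → ℕ)
    (C : Finset (Fin n → ℚ)) : ℕ :=
  ((smallElements S).filter fun s => (columnVectors I ref s ∩ C).Nonempty).sup id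

/-- The syzygetic defect `D(k)`. -/
def syzygeticDefect (S : AddSubmonoid ℕ) (I : ℕ → Finset (Fin n → ℕ)) (ref : ℕ → Fin n → ℕ) : ℕ :=
  ∑ C ∈ circuits S I ref, rho S (topElement S I ref C)

/-- The minimal generators of `S` less than the conductor that are not entries of `k`. -/
def missingGenerators (S : AddSubmonoid ℕ) (k : Fin (n + 1) → ℕ) : Finset ℕ :=
  (Finset.range (conductor S)).filter fun s => IsMinimalGenerator S s ∧ s ∉ Set.range k

/-- `m = min(ℓ, ∑_{s ∈ S} φ(s))`, where `ℓ` is the number of missing generators; only finitely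
many `φ(s)` are nonzero. -/
def correctionLength (S : AddSubmonoid ℕ) (k : Fin (n + 1) → ℕ) (I : ℕ → Finset (Fin n → ℕ)) : ℕ :=
  min (missingGenerators S k).card (∑ᶠ s ∈ S, phi I s)

/-- `∑_{i ≤ m} ρ(s*_i)`, where `s*_1 < s*_2 < ⋯` are the missing generators. -/
def generatorCorrection (S : AddSubmonoid ℕ) (k : Fin (n + 1) → ℕ)
    (I : ℕ → Finset (Fin n → ℕ)) : ℕ :=
  ((((missingGenerators S k).sort (· ≤ ·)).take (correctionLength S k I)).map (rho S)).sum

/-- `∑ (k_i - i) + ∑_{s ∈ S ∩ [2g]} φ(s) ρ(s) - ∑_{i ≤ m} ρ(s*_i) - D(k) - 1`. -/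
def expectedCodim (S : AddSubmonoid ℕ) (k : Fin (n + 1) → ℕ) (I : ℕ → Finset (Fin n → ℕ))
    (ref : ℕ → Fin n → ℕ) : ℤ :=
  (∑ i : Fin n, ((k i.succ : ℤ) - ((i : ℤ) + 1)))
    + (∑ s ∈ (Finset.Icc 1 (2 * genus S)).filter (· ∈ S), ((phi I s * rho S s : ℕ) : ℤ))
    - (generatorCorrection S k I : ℤ) - (syzygeticDefect S I ref : ℤ) - 1

end Decompositions

end Severi

end

/-!
Near the singular point, a morphism in the stratum has a normal form: up to a choice of the point
(one parameter) and of a basis of its forms (`(n + 1)²` parameters), the forms are a reduced echelon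
basis with pivots `k`, whose free coefficients are counted by `freePositions`. The codimension of
the stratum is bounded by bounding the transcendence degree of these parameters at each generic
point.

If `v` and `ref s` are two decompositions of `s ∈ S`, the difference of the corresponding monomials
in the affine coordinates has order greater than `s`. Subtracting multiples of monomials in
generators of the local ring removes its terms whose exponents lie in `S`; as all orders lie in `S`,
the coefficients at the gaps greater than `s` vanish as well. The coefficient of `t ^ (s + j)` in
the resulting equation is linear in the coefficients at distance `j` from the pivots, with
coefficient vector `v - ref s`, up to terms involving only coefficients at distance less than `j`.
So, by induction on `j`, as many coefficients are rational functions of the others as the span of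
the active vectors `v - ref s` has dimension. Each circuit lowers this dimension by at most one,
at distances bounded by its top element, which accounts for the defect `D(k)`.

The generators of `S` that are not entries of `k` bring further free coefficients. Only the gaps
below a cutoff `q` are used: then only the generators less than `q` matter, and the best choice of
`q` leaves the correction by the sum over the first `m` generators.
-/

namespace Severi

/-! ### Codimension and transcendence degree -/

section Height

open MvPolynomial

variable {k L σ : Type*} [Field k] [Field L] [Algebra k L]

/-- Evaluation at `x` of the variables in `T` only. As `T` grows, the kernels of these maps form
chains of prime ideals ending in the kernel of the evaluation at `x`. -/
noncomputable def partialEval (x : σ → L) (T : Set σ) : MvPolynomial σ k →ₐ[k] MvPolynomial σ L :=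
  aeval fun i => if i ∈ T then C (x i) else X i

lemma partialEval_insert (x : σ → L) (T : Set σ) (i : σ) (p : MvPolynomial σ k) :
    partialEval x (insert i T) p = partialEval x {i} (partialEval x T p) := by
  have : partialEval (k := k) x (insert i T) =
      ((partialEval x {i}).restrictScalars k).comp (partialEval x T) := by
    ext j : 1
    obtain rfl | hj := eq_or_ne j i <;> by_cases hT : j ∈ T <;>
      simp [partialEval, *, algebraMap_eq]
  exact DFunLike.congr_fun this p

lemma exists_partialEval_eq_C {x : σ → L} {T : Set σ} {c : L}
    (hc : c ∈ Algebra.adjoin k (x '' T)) : ∃ p : MvPolynomial σ k, partialEval x T p = C c := by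
  suffices Algebra.adjoin k (x '' T) ≤
      (partialEval x T).range.comap (IsScalarTower.toAlgHom k L (MvPolynomial σ L)) from this hc
  rw [Algebra.adjoin_le_iff]
  rintro _ ⟨i, hi, rfl⟩
  exact ⟨X i, by simp [partialEval, hi, algebraMap_eq]⟩

lemma ker_partialEval_lt {x : σ → L} {T : Set σ} {i : σ} (hi : i ∉ T)
    (halg : IsAlgebraic (Algebra.adjoin k (x '' T)) (x i)) :
    RingHom.ker (partialEval (k := k) x T) <
      RingHom.ker (partialEval (k := k) x (insert i T)) := by
  obtain ⟨f, hf0, hf⟩ := halg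
  choose q hq using fun m => exists_partialEval_eq_C (f.coeff m).2
  set G : MvPolynomial σ k := ∑ m ∈ Finset.range (f.natDegree + 1), q m * X i ^ m with hG
  have hTG : partialEval x T G =
      Polynomial.aeval (X i : MvPolynomial σ L) (f.map (algebraMap _ L)) := by
    rw [Polynomial.aeval_eq_sum_range, Polynomial.natDegree_map_eq_of_injective
      (FaithfulSMul.algebraMap_injective _ _)]
    have hX : partialEval x T (X i : MvPolynomial σ k) = X i := by simp [partialEval, hi]
    simp [hG, hq, hX, smul_eq_C_mul]
  have hmem : partialEval x (insert i T) G = 0 := by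
    rw [partialEval_insert, hTG, ← Polynomial.aeval_algHom_apply, Polynomial.aeval_map_algebraMap]
    simpa [partialEval, algebraMap_eq] using
      (Polynomial.aeval_algebraMap_apply (MvPolynomial σ L) (x i) f).trans (by rw [hf, map_zero])
  have hnotMem : partialEval x T G ≠ 0 := by
    rw [hTG]
    intro h
    refine (Polynomial.map_ne_zero_iff (FaithfulSMul.algebraMap_injective _ L)).2 hf0 ?_
    exact transcendental_iff.1 (transcendental_X L i) _ h
  refine SetLike.lt_iff_le_and_exists.2 ⟨fun p hp => ?_, G, hmem, hnotMem⟩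
  rw [RingHom.mem_ker] at hp ⊢
  rw [partialEval_insert, hp, map_zero]

lemma card_le_height_ker_partialEval {x : σ → L} {B : Set σ}
    (hB : ∀ i, IsAlgebraic (Algebra.adjoin k (x '' B)) (x i)) (T : Finset σ)
    (hT : Disjoint (T : Set σ) B) :
    (T.card : ℕ∞) ≤ (RingHom.ker (partialEval (k := k) x (T ∪ B))).height := by
  induction T using Finset.induction_on with
  | empty => simp
  | insert i T hi ih =>
    rw [Finset.coe_insert, Set.disjoint_insert_left] at hT
    rw [Finset.card_insert_of_notMem hi, Finset.coe_insert, Set.insert_union, Nat.cast_add,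
      Nat.cast_one]
    have := RingHom.ker_isPrime (partialEval (k := k) x (T ∪ B))
    have := RingHom.ker_isPrime (partialEval (k := k) x (insert i (T ∪ B)))
    have halg : IsAlgebraic (Algebra.adjoin k (x '' (T ∪ B))) (x i) :=
      (hB i).adjoin_of_forall_isAlgebraic fun a ha =>
        absurd (Set.image_mono Set.subset_union_right ha.1) ha.2
    exact (add_le_add_left (ih hT.2) 1).trans <|
      Ideal.height_add_one_le_of_lt_of_isPrime <| ker_partialEval_lt (by simp [hi, hT.1]) halg

lemma ker_partialEval_univ (x : σ → L) :
    RingHom.ker (partialEval (k := k) x Set.univ) = RingHom.ker (aeval (R := k) x) := by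
  have : partialEval (k := k) x Set.univ =
      (IsScalarTower.toAlgHom k L (MvPolynomial σ L)).comp (aeval x) := by
    ext i : 1
    simp [partialEval, algebraMap_eq]
  ext p
  rw [RingHom.mem_ker, RingHom.mem_ker, this, AlgHom.comp_apply]
  exact map_eq_zero_iff _ (C_injective σ L)

theorem card_le_height_ker_aeval_add_eRk [Fintype σ] (x : σ → L) :
    (Fintype.card σ : ℕ∞) ≤ (RingHom.ker (aeval (R := k) x)).height +
      (AlgebraicIndependent.matroid k L).eRk (Set.range x) := by
  obtain ⟨A, hA⟩ := (AlgebraicIndependent.matroid k L).exists_isBasis (Set.range x)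
  obtain ⟨B, rfl, hinj⟩ := Set.exists_image_eq_injOn_of_subset_range hA.subset
  have halg : ∀ i, IsAlgebraic (Algebra.adjoin k (x '' B)) (x i) := fun i =>
    (AlgebraicIndependent.matroid_isBasis_iff.1 hA).2.2 _ ⟨i, rfl⟩
  have hheight := card_le_height_ker_partialEval halg Bᶜ.toFinset
    (by simpa using disjoint_compl_left)
  rw [Set.coe_toFinset, Set.compl_union_self, ker_partialEval_univ] at hheight
  rw [← hA.encard_eq_eRk, hinj.encard_image, Set.encard_eq_coe_toFinset_card]
  refine le_trans ?_ (add_le_add_left hheight _)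
  rw [← Nat.cast_add, Set.toFinset_compl, Finset.card_compl_add_card]

lemma eRk_range_le_encard {ι : Type*} {x : ι → L} {s : Set L}
    (h : ∀ i, x i ∈ IntermediateField.adjoin k s) :
    (AlgebraicIndependent.matroid k L).eRk (Set.range x) ≤ s.encard := by
  refine le_trans ?_ ((AlgebraicIndependent.matroid k L).eRk_le_encard s)
  rw [← Matroid.eRk_closure_eq _ s, AlgebraicIndependent.matroid_closure_eq]
  refine Matroid.eRk_mono _ ?_
  rintro _ ⟨i, rfl⟩
  obtain ⟨r, hr, t, ht, hrt⟩ := IntermediateField.mem_adjoin_iff_div.1 (h i)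
  rw [SetLike.mem_coe, Subalgebra.mem_algebraicClosure, hrt, div_eq_mul_inv]
  exact (isAlgebraic_algebraMap (⟨r, hr⟩ : Algebra.adjoin k s)).mul
    (isAlgebraic_algebraMap (⟨t, ht⟩ : Algebra.adjoin k s)).inv

/-- The minimal primes of the vanishing ideal of `Z` are contracted from primes of the ring of all
functions on `Z`. Hence the generic points of the closure of `Z` may be treated like actual points
of `Z`: any identity that holds on `Z` is inherited by the coordinates of the generic points. -/
theorem card_le_codim_add {σ : Type} [Fintype σ] {Z : Set (σ → ℂ)} {M : ℕ∞}
    (h : ∀ (L : Type) [Field L] [Algebra ℂ L] (π : (Z → ℂ) →ₐ[ℂ] L),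
      ∃ s : Set L, s.encard ≤ M ∧
        ∀ i, π (fun z => z.1 i) ∈ IntermediateField.adjoin ℂ s) :
    (Fintype.card σ : ℕ∞) ≤ codim Z + M := by
  let Φ : MvPolynomial σ ℂ →ₐ[ℂ] (Z → ℂ) := aeval fun i z => z.1 i
  have hΦ : vanishingIdeal ℂ Z = (⊥ : Ideal (Z → ℂ)).comap (Φ : MvPolynomial σ ℂ →+* Z → ℂ) := by
    have heval : ∀ p z, Φ p z = aeval z.1 p := fun p z => by
      have : (Pi.evalAlgHom ℂ (fun _ : Z => ℂ) z).comp Φ = aeval z.1 := by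
        ext i
        simp [Φ]
      exact DFunLike.congr_fun this p
    ext p
    simp [funext_iff, heval]
  rw [codim, Ideal.height_eq_inf_minimalPrimes]
  simp only [ENat.iInf_add]
  refine le_iInf₂ fun J hJ => ?_
  rw [hΦ] at hJ
  obtain ⟨𝔓, h𝔓, -, rfl⟩ := Ideal.exists_comap_eq_of_mem_minimalPrimes _ J hJ
  let L := FractionRing ((Z → ℂ) ⧸ 𝔓)
  let π : (Z → ℂ) →ₐ[ℂ] L :=
    (IsScalarTower.toAlgHom ℂ ((Z → ℂ) ⧸ 𝔓) L).comp (Ideal.Quotient.mkₐ ℂ 𝔓)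
  have hker : 𝔓.comap (Φ : MvPolynomial σ ℂ →+* Z → ℂ) =
      RingHom.ker (aeval (R := ℂ) fun i => π fun z => z.1 i) := by
    have hcomp : (aeval fun i => π fun z => z.1 i) = π.comp Φ := by
      ext i
      simp [Φ]
    ext p
    rw [hcomp, RingHom.mem_ker, Ideal.mem_comap, ← Ideal.Quotient.eq_zero_iff_mem,
      ← (FaithfulSMul.algebraMap_injective ((Z → ℂ) ⧸ 𝔓) L).eq_iff, map_zero]
    rfl
  obtain ⟨s, hM, hs⟩ := h L π
  exact hker ▸ (card_le_height_ker_aeval_add_eRk _).trans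
    (add_le_add_right ((eRk_range_le_encard hs).trans hM) _)

lemma min_height_le_height_inf {R : Type*} [CommRing R] (I J : Ideal R) :
    min I.height J.height ≤ (I ⊓ J).height := by
  rw [(I ⊓ J).height_eq_inf_minimalPrimes]
  refine le_iInf₂ fun P hP => ?_
  rcases (Ideal.IsPrime.inf_le hP.1.1).1 hP.1.2 with h | h
  · exact min_le_of_left_le (Ideal.height_mono h)
  · exact min_le_of_right_le (Ideal.height_mono h)

lemma min_codim_le_codim_union {σ : Type} (Z W : Set (σ → ℂ)) :
    min (codim Z) (codim W) ≤ codim (Z ∪ W) := by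
  have : vanishingIdeal ℂ (Z ∪ W) = vanishingIdeal ℂ Z ⊓ vanishingIdeal ℂ W :=
    zeroLocus_vanishingIdeal_galoisConnection.u_inf
  rw [codim, codim, codim, this]
  exact min_height_le_height_inf _ _

end Height

/-! ### Circuits and ranks -/

section LinearAlgebra

variable {K : Type*} [Field K]

lemma card_eq_finrank_of_pivots {ι : Type*} {V : Submodule K (ι → K)} {E : Finset ι}
    (hsep : ∀ v ∈ V, (∀ i ∈ E, v i = 0) → v = 0)
    (hpiv : ∀ i ∈ E, ∃ v ∈ V, v i = 1 ∧ ∀ i' ∈ E, i' ≠ i → v i' = 0) :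
    E.card = Module.finrank K V := by
  choose v hv hv1 hv0 using hpiv
  let restrict : V →ₗ[K] (E → K) := LinearMap.pi fun i => (LinearMap.proj i.1).comp V.subtype
  have hinj : Function.Injective restrict := by
    rw [← LinearMap.ker_eq_bot, LinearMap.ker_eq_bot']
    exact fun x hx => Subtype.ext (hsep x x.2 fun i hi => congrFun hx ⟨i, hi⟩)
  have hsurj : Function.Surjective restrict := by
    intro y
    refine ⟨∑ i : E, y i • ⟨v i i.2, hv i i.2⟩, funext fun i' => ?_⟩
    rw [map_sum, Finset.sum_apply, Finset.sum_eq_single i']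
    · simp [restrict, hv1]
    · intro i _ hne
      simp [restrict, hv0 i i.2 i' i'.2 fun h => hne (Subtype.ext h.symm)]
    · simp
  simp [(LinearEquiv.ofBijective restrict ⟨hinj, hsurj⟩).finrank_eq]

lemma exists_pivots {ι : Type*} {V : Submodule K (ι → K)} {U : Finset ι}
    (hU : ∀ v ∈ V, (∀ i ∈ U, v i = 0) → v = 0) :
    ∃ E ⊆ U, E.card = Module.finrank K V ∧
      ∀ i ∈ E, ∃ v ∈ V, v i = 1 ∧ ∀ i' ∈ E, i' ≠ i → v i' = 0 := by
  obtain ⟨E, ⟨hEU, hsep⟩, hmin⟩ := exists_minimal_of_wellFoundedLT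
    (fun E : Finset ι => E ⊆ U ∧ ∀ v ∈ V, (∀ i ∈ E, v i = 0) → v = 0) ⟨U, subset_rfl, hU⟩
  have hpiv : ∀ i ∈ E, ∃ v ∈ V, v i = 1 ∧ ∀ i' ∈ E, i' ≠ i → v i' = 0 := by
    intro i hi
    have hnsep : ¬ ∀ v ∈ V, (∀ i' ∈ E.erase i, v i' = 0) → v = 0 := fun h =>
      Finset.notMem_erase i E
        (hmin ⟨(Finset.erase_subset _ _).trans hEU, h⟩ (Finset.erase_subset _ _) hi)
    push Not at hnsep
    obtain ⟨v, hv, hvE, hv0⟩ := hnsep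
    have hvi : v i ≠ 0 := fun h => hv0 <| hsep v hv fun i' hi' => by
      obtain rfl | hne := eq_or_ne i' i
      exacts [h, hvE i' (Finset.mem_erase.2 ⟨hne, hi'⟩)]
    refine ⟨(v i)⁻¹ • v, V.smul_mem _ hv, by simp [hvi], fun i' hi' hne => ?_⟩
    simp [hvE i' (Finset.mem_erase.2 ⟨hne, hi'⟩)]
  exact ⟨E, hEU, card_eq_finrank_of_pivots hsep hpiv, hpiv⟩

variable {M : Type*} [AddCommGroup M] [Module K M]

variable (K) in
/-- A circuit of the vector matroid: a minimal linearly dependent set of vectors. -/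
def IsLinearCircuit (C : Finset M) : Prop :=
  ¬ LinearIndepOn K id (C : Set M) ∧ ∀ C' ⊂ C, LinearIndepOn K id (C' : Set M)

lemma exists_isLinearCircuit_of_not_linearIndepOn {A : Finset M}
    (hA : ¬ LinearIndepOn K id (A : Set M)) : ∃ C ⊆ A, IsLinearCircuit K C := by
  obtain ⟨C, ⟨hCA, hC⟩, hmin⟩ := exists_minimal_of_wellFoundedLT
    (fun C : Finset M => C ⊆ A ∧ ¬ LinearIndepOn K id (C : Set M)) ⟨A, subset_rfl, hA⟩
  refine ⟨C, hCA, hC, fun C' hC' => ?_⟩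
  by_contra h
  exact hC'.2 (hmin ⟨hC'.1.trans hCA, h⟩ hC'.1)

lemma card_le_finrank_span_add_card_circuits (E : Finset M) :
    E.card ≤ Module.finrank K (Submodule.span K (E : Set M)) +
      (E.powerset.filter fun C => IsLinearCircuit K C).card := by
  obtain ⟨B, ⟨hBE, hB⟩, hmax⟩ := (E.powerset.filter fun C : Finset M =>
    LinearIndepOn K id (C : Set M)).exists_maximal ⟨∅, by simp⟩ |>.imp fun B h =>
      (⟨by simpa using h.1, h.2⟩ : (B ⊆ E ∧ LinearIndepOn K id (B : Set M)) ∧ _)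
  have hrank : B.card ≤ Module.finrank K (Submodule.span K (E : Set M)) :=
    (finrank_span_finset_eq_card (R := K) hB).symm.trans_le
      (Submodule.finrank_mono (Submodule.span_mono hBE))
  -- Each vector outside the basis `B` is recovered from its fundamental circuit.
  have hcirc : ∀ e ∈ E \ B, ∃ C ⊆ insert e B, e ∈ C ∧ IsLinearCircuit K C := by
    intro e he
    rw [Finset.mem_sdiff] at he
    obtain ⟨C, hCsub, hC⟩ := exists_isLinearCircuit_of_not_linearIndepOn (K := K)
      (A := insert e B) fun h => he.2 (hmax (Finset.mem_filter.2 ⟨Finset.mem_powerset.2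
        (Finset.insert_subset he.1 hBE), h⟩) (Finset.subset_insert e B)
        (Finset.mem_insert_self e B))
    refine ⟨C, hCsub, ?_, hC⟩
    by_contra h
    exact hC.1 (hB.mono ((Finset.subset_insert_iff_of_notMem h).1 hCsub))
  choose! C hCsub hCmem hC using hcirc
  have hle : (E \ B).card ≤ (E.powerset.filter fun C => IsLinearCircuit K C).card := by
    refine Finset.card_le_card_of_injOn C (fun e he => ?_) fun e he e' he' h => ?_
    · exact Finset.mem_filter.2 ⟨Finset.mem_powerset.2 ((hCsub e he).trans
        (Finset.insert_subset (Finset.mem_sdiff.1 he).1 hBE)), hC e he⟩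
    · exact (Finset.mem_insert.1 (hCsub e' he' (h ▸ hCmem e he))).resolve_right
        (Finset.mem_sdiff.1 he).2
  have := Finset.card_sdiff_add_card_eq_card hBE
  omega

end LinearAlgebra

/-! ### Unlinked families of decompositions -/

section Decompositions

variable {n : ℕ} {k : Fin (n + 1) → ℕ}

lemma value_add (v w : Fin n → ℕ) : value k (v + w) = value k v + value k w := by
  simp [value, add_mul, Finset.sum_add_distrib]

lemma value_single (i : Fin n) (m : ℕ) : value k (Pi.single i m) = m * k i.succ := by
  rw [value, Finset.sum_eq_single i] <;> simp +contextual

lemma exists_apply_ne_zero_of_value_ne_zero {v : Fin n → ℕ} (h : value k v ≠ 0) :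
    ∃ i, v i ≠ 0 := by
  obtain ⟨i, -, hi⟩ := Finset.exists_ne_zero_of_sum_ne_zero h
  exact ⟨i, left_ne_zero_of_mul hi⟩

lemma exists_lt_apply_of_mul_sum_lt_value {v : Fin n → ℕ} {b : ℕ}
    (h : b * ∑ i : Fin n, k i.succ < value k v) : ∃ i, b < v i := by
  by_contra! hle
  refine h.not_ge ?_
  rw [value, Finset.mul_sum]
  exact Finset.sum_le_sum fun i _ => Nat.mul_le_mul_right _ (hle i)

lemma value_eq_of_mem_decompositions {s : ℕ} {v : Fin n → ℕ} (hv : v ∈ decompositions k s) :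
    value k v = s :=
  (Finset.mem_filter.1 hv).2

lemma single_add_sub_single {v : Fin n → ℕ} {i : Fin n} {m : ℕ} (h : m ≤ v i) :
    Pi.single i m + (v - Pi.single i m) = v :=
  add_tsub_cancel_of_le (update_le_iff.2 ⟨h, fun _ _ => Nat.zero_le _⟩)

lemma trade_of_apply_ne_zero {v w : Fin n → ℕ} {i : Fin n} (hv : v i ≠ 0) (hw : w i ≠ 0)
    (h : value k v = value k w) : Trade k v w := by
  have hv' := single_add_sub_single (Nat.one_le_iff_ne_zero.2 hv)
  have hw' := single_add_sub_single (Nat.one_le_iff_ne_zero.2 hw)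
  refine ⟨v - Pi.single i 1, w - Pi.single i 1, Pi.single i 1, fun h => ?_,
    by rw [add_comm, hv'], by rw [add_comm, hw'], ?_⟩
  · simpa using congrFun h i
  · rw [← hv', ← hw', value_add, value_add] at h
    exact Nat.add_left_cancel h

/-- `k l` copies of the part `k i` are first replaced by `k i` copies of `k l`; the result has
the part `k l` in common with `w`. -/
lemma reflTransGen_trade_of_lt {v w : Fin n → ℕ} {i l : Fin n} (hi : k i.succ ≠ 0)
    (hv : k l.succ < v i) (hw : w l ≠ 0) (h : value k v = value k w) :
    Relation.ReflTransGen (Trade k) v w := by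
  set r : Fin n → ℕ := v - Pi.single i (k l.succ)
  have hvr : Pi.single i (k l.succ) + r = v := single_add_sub_single hv.le
  have hr : r ≠ 0 := fun h0 => by
    have : v i - k l.succ = 0 := by simpa [r] using congrFun h0 i
    omega
  have hval : value k (Pi.single l (k i.succ)) = value k (Pi.single i (k l.succ)) := by
    rw [value_single, value_single, mul_comm]
  have hswap : Trade k v (Pi.single l (k i.succ) + r) := ⟨_, _, r, hr, hvr.symm, rfl, hval.symm⟩
  refine .tail (.single hswap) (trade_of_apply_ne_zero (i := l) (by simp [hi]) hw ?_)
  rw [value_add, hval, ← value_add, hvr, h]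

/-- Families of decompositions, at most one of each class for the equivalence relation generated
by trades. Both choices of the set `I s` in the theorem are of this kind. -/
def Unlinked (k : Fin (n + 1) → ℕ) (I : ℕ → Finset (Fin n → ℕ)) : Prop :=
  ∀ s, I s ⊆ decompositions k s ∧
    ∀ v ∈ I s, ∀ w ∈ I s, Relation.ReflTransGen (Trade k) v w → v = w

lemma Trade.eq_of_not_reducible {v w : Fin n → ℕ} (h : Trade k v w) (hv : ¬ Reducible k v) :
    v = w := by
  obtain ⟨u, u', r, hr, hu, rfl, huu'⟩ := h
  by_contra hne
  exact hv ⟨u, u', r, hr, hu, fun h => hne (by rw [hu, h]), huu'⟩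

lemma unlinked_irreducibleDecompositions : Unlinked k (irreducibleDecompositions k) := by
  refine fun s => ⟨Finset.filter_subset _ _, fun v hv w _ h => ?_⟩
  have hv : ¬ Reducible k v := (Finset.mem_filter.1 hv).2
  clear * - hv h
  induction h with
  | refl => rfl
  | tail _ h ih => exact ih.trans (h.eq_of_not_reducible (ih ▸ hv))

lemma IsSystemOfRepresentatives.unlinked {I : ℕ → Finset (Fin n → ℕ)}
    (hI : IsSystemOfRepresentatives k I) : Unlinked k I := by
  refine fun s => ⟨(hI s).1, fun v hv w hw h => ?_⟩
  obtain ⟨x, -, hx⟩ := (hI s).2 v ((hI s).1 hv)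
  rw [hx v ⟨hv, .refl⟩, hx w ⟨hw, h⟩]

namespace Unlinked

variable {I : ℕ → Finset (Fin n → ℕ)}

lemma value_eq (hI : Unlinked k I) {s : ℕ} {v : Fin n → ℕ} (hv : v ∈ I s) : value k v = s :=
  value_eq_of_mem_decompositions ((hI s).1 hv)

lemma eq_of_reflTransGen (hI : Unlinked k I) {s : ℕ} {v w : Fin n → ℕ} (hv : v ∈ I s)
    (hw : w ∈ I s) (h : Relation.ReflTransGen (Trade k) v w) : v = w :=
  (hI s).2 v hv w hw h

lemma apply_eq_zero_or (hI : Unlinked k I) {s : ℕ} {v w : Fin n → ℕ} (hv : v ∈ I s) (hw : w ∈ I s)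
    (hne : v ≠ w) (i : Fin n) : v i = 0 ∨ w i = 0 := by
  by_contra! h
  exact hne (hI.eq_of_reflTransGen hv hw
    (.single (trade_of_apply_ne_zero h.1 h.2 ((hI.value_eq hv).trans (hI.value_eq hw).symm))))

/-- As `v` and `w` have disjoint supports, `v` is the positive part of `diff v w`. -/
lemma eq_and_eq_of_diff_eq (hI : Unlinked k I) {s s' : ℕ} {v w v' w' : Fin n → ℕ} (hv : v ∈ I s)
    (hw : w ∈ I s) (hvw : v ≠ w) (hv' : v' ∈ I s') (hw' : w' ∈ I s') (hvw' : v' ≠ w')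
    (h : diff v w = diff v' w') : s = s' ∧ v = v' := by
  have hvv : v = v' := by
    ext i
    have hdiff : (v i : ℚ) - w i = v' i - w' i := congrFun h i
    have hsum : v i + w' i = v' i + w i := by
      have : (v i : ℚ) + w' i = v' i + w i := by linarith
      exact_mod_cast this
    have := hI.apply_eq_zero_or hv hw hvw i
    have := hI.apply_eq_zero_or hv' hw' hvw' i
    omega
  exact ⟨by rw [← hI.value_eq hv, hvv, hI.value_eq hv'], hvv⟩

lemma phi_eq_zero (hI : Unlinked k I) (hk : ∀ i : Fin n, k i.succ ≠ 0) {s : ℕ}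
    (hs : (∑ i : Fin n, k i.succ) * (∑ i : Fin n, k i.succ) < s) : phi I s = 0 := by
  suffices (I s).card ≤ 1 from Nat.sub_eq_zero_of_le this
  refine Finset.card_le_one.2 fun v hv w hw => ?_
  obtain ⟨i, hi⟩ := exists_lt_apply_of_mul_sum_lt_value (hs.trans_eq (hI.value_eq hv).symm)
  obtain ⟨l, hl⟩ := exists_apply_ne_zero_of_value_ne_zero
    ((hI.value_eq hw).trans_ne (Nat.ne_zero_of_lt hs))
  have hlK : k l.succ ≤ ∑ i : Fin n, k i.succ :=
    Finset.single_le_sum (f := fun i : Fin n => k i.succ) (fun _ _ => Nat.zero_le _)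
      (Finset.mem_univ l)
  exact hI.eq_of_reflTransGen hv hw (reflTransGen_trade_of_lt (hk i) (hlK.trans_lt hi) hl
    ((hI.value_eq hv).trans (hI.value_eq hw).symm))

end Unlinked

end Decompositions

/-! ### Counting syzygies and gaps -/

section Gaps

variable {S : AddSubmonoid ℕ}

lemma mem_of_conductor_le (hS : {r : ℕ | r ∉ S}.Finite) {r : ℕ} (hr : conductor S ≤ r) :
    r ∈ S := by
  obtain ⟨b, hb⟩ := hS.bddAbove
  have hne : {c : ℕ | ∀ r, c ≤ r → r ∈ S}.Nonempty :=
    ⟨b + 1, fun r hr => by_contra fun h => (Nat.lt_of_succ_le hr).not_ge (hb h)⟩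
  exact Nat.sInf_mem hne r hr

lemma lt_conductor (hS : {r : ℕ | r ∉ S}.Finite) {r : ℕ} (hr : r ∉ S) : r < conductor S :=
  not_le.1 fun h => hr (mem_of_conductor_le hS h)

/-- If `r` is a gap, then `x ↦ r - x` maps the elements of `S` up to `r` to gaps, so at least half
of the numbers `0, …, r` are gaps. -/
lemma lt_two_mul_genus (hS : {r : ℕ | r ∉ S}.Finite) {r : ℕ} (hr : r ∉ S) :
    r < 2 * genus S := by
  have hhalf : (Finset.range (r + 1)).card ≤
      2 * ((Finset.range (r + 1)).filter (· ∉ S)).card := by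
    rw [← Finset.card_filter_add_card_filter_not (s := Finset.range (r + 1)) (· ∉ S), two_mul]
    refine Nat.add_le_add_left (Finset.card_le_card_of_injOn (fun x => r - x) (fun x hx => ?_)
      fun x hx y hy h => ?_) _
    · simp only [Finset.coe_filter, Finset.mem_range, not_not, Set.mem_ofPred_eq] at hx ⊢
      refine ⟨by omega, fun h => hr ?_⟩
      have := S.add_mem hx.2 h
      rwa [Nat.add_sub_cancel' (by omega)] at this
    · simp only [Finset.coe_filter, Finset.mem_range, Set.mem_ofPred_eq] at hx hy h
      omega
  have hgaps : ((Finset.range (r + 1)).filter (· ∉ S)).card ≤ genus S := by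
    rw [genus, ← Set.ncard_coe_finset]
    exact Set.ncard_le_ncard (fun x hx => (Finset.mem_filter.1 hx).2) hS
  rw [Finset.card_range] at hhalf
  omega

/-- The number of gaps of `S` between `s` and `q`; it replaces `rho S s` when only the gaps below
a cutoff `q` are taken into account. -/
noncomputable def rhoBelow (S : AddSubmonoid ℕ) (q s : ℕ) : ℕ :=
  ((Finset.range q).filter fun r => s < r ∧ r ∉ S).card

lemma rho_le_of_le (hS : {r : ℕ | r ∉ S}.Finite) {s t : ℕ} (h : s ≤ t) : rho S t ≤ rho S s :=
  Set.ncard_le_ncard (fun _ hr => ⟨h.trans_lt hr.1, hr.2⟩) (hS.subset fun _ hr => hr.2)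

lemma rhoBelow_le_rho (hS : {r : ℕ | r ∉ S}.Finite) (q s : ℕ) : rhoBelow S q s ≤ rho S s := by
  rw [rho, rhoBelow, ← Set.ncard_coe_finset]
  exact Set.ncard_le_ncard (fun _ hr => (Finset.mem_filter.1 hr).2) (hS.subset fun _ hr => hr.2)

lemma rho_eq_rhoBelow_add_rho (hS : {r : ℕ | r ∉ S}.Finite) {q s : ℕ} (hq : q ∈ S) (hs : s ≤ q) :
    rho S s = rhoBelow S q s + rho S q := by
  have hfin : {r : ℕ | q < r ∧ r ∉ S}.Finite := hS.subset fun r hr => hr.2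
  rw [rho, rho, rhoBelow, ← Set.ncard_coe_finset,
    ← Set.ncard_union_eq ?_ (Finset.finite_toSet _) hfin]
  · congr 1
    ext r
    simp only [Finset.coe_filter, Finset.mem_range, Set.mem_ofPred_eq, Set.mem_union]
    constructor
    · rintro ⟨hsr, hr⟩
      rcases lt_trichotomy r q with h | rfl | h
      exacts [.inl ⟨h, hsr, hr⟩, absurd hq hr, .inr ⟨h, hr⟩]
    · rintro (h | h)
      exacts [h.2, ⟨hs.trans_lt h.1, h.2⟩]
  · refine Set.disjoint_left.2 fun r hr hr' => ?_
    exact (Finset.mem_range.1 (Finset.mem_filter.1 hr).1).not_gt hr'.1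

lemma rho_le_rhoBelow_add_rho (hS : {r : ℕ | r ∉ S}.Finite) {q : ℕ} (hq : q ∈ S) (s : ℕ) :
    rho S s ≤ rhoBelow S q s + rho S q := by
  rcases le_total s q with h | h
  · exact (rho_eq_rhoBelow_add_rho hS hq h).le
  · exact (rho_le_of_le hS h).trans (Nat.le_add_left _ _)

lemma rho_conductor (hS : {r : ℕ | r ∉ S}.Finite) : rho S (conductor S) = 0 := by
  rw [rho, Set.ncard_eq_zero (hS.subset fun r hr => hr.2), Set.eq_empty_iff_forall_notMem]
  exact fun r hr => hr.2 (mem_of_conductor_le hS hr.1.le)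

lemma card_filter_Icc_eq_rhoBelow (S : AddSubmonoid ℕ) (q s : ℕ) :
    ((Finset.Icc 1 q).filter fun j => s + j ∉ S ∧ s + j < q).card = rhoBelow S q s := by
  refine Finset.card_bij (fun j _ => s + j) (fun j hj => ?_) (fun a _ b _ h => by omega)
    fun r hr => ?_
  · simp only [Finset.mem_filter, Finset.mem_Icc, Finset.mem_range] at hj ⊢
    exact ⟨hj.2.2, by omega, hj.2.1⟩
  · simp only [Finset.mem_filter, Finset.mem_range] at hr
    refine ⟨r - s, ?_, by omega⟩
    simp only [Finset.mem_filter, Finset.mem_Icc]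
    rw [Nat.add_sub_cancel' hr.2.1.le]
    exact ⟨by omega, hr.2.2, hr.1⟩

end Gaps

section Syzygies

variable {n : ℕ} {S : AddSubmonoid ℕ} {k : Fin (n + 1) → ℕ} {I : ℕ → Finset (Fin n → ℕ)}
  {ref : ℕ → Fin n → ℕ}

/-- The index set of the vectors of the matroid: pairs `(s, v)` of a nonzero element `s` of `S`
below the conductor and a decomposition `v ∈ I s` other than the reference decomposition. -/
noncomputable def syzygies (S : AddSubmonoid ℕ) (I : ℕ → Finset (Fin n → ℕ)) (ref : ℕ → Fin n → ℕ) :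
    Finset (Σ _ : ℕ, Fin n → ℕ) :=
  (smallElements S).sigma fun s => (I s).erase (ref s)

/-- The vector of the matroid with index `(s, v)`. -/
def syzygyVector (ref : ℕ → Fin n → ℕ) (σ : Σ _ : ℕ, Fin n → ℕ) : Fin n → ℚ :=
  diff σ.2 (ref σ.1)

/-- The pairs `(s, v)` for which `s + j` is a gap less than `q`: these are the pairs that impose a
condition on the coefficients at distance `j` from the pivots. -/
noncomputable def activeSyzygies (S : AddSubmonoid ℕ) (I : ℕ → Finset (Fin n → ℕ))
    (ref : ℕ → Fin n → ℕ) (q j : ℕ) : Finset (Σ _ : ℕ, Fin n → ℕ) :=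
  (syzygies S I ref).filter fun σ => σ.1 + j ∉ S ∧ σ.1 + j < q

/-- The vectors of the active pairs `(s, v)`. -/
noncomputable def activeVectors (S : AddSubmonoid ℕ) (I : ℕ → Finset (Fin n → ℕ))
    (ref : ℕ → Fin n → ℕ) (q j : ℕ) : Finset (Fin n → ℚ) :=
  (activeSyzygies S I ref q j).image (syzygyVector ref)

/-- The span of the vectors of the active pairs `(s, v)`; its dimension is the number of
independent conditions on the coefficients at distance `j` from the pivots. -/
def activeSpan (S : AddSubmonoid ℕ) (I : ℕ → Finset (Fin n → ℕ)) (ref : ℕ → Fin n → ℕ)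
    (q j : ℕ) : Submodule ℚ (Fin n → ℚ) :=
  Submodule.span ℚ (activeVectors S I ref q j : Set (Fin n → ℚ))

lemma mem_syzygies {σ : Σ _ : ℕ, Fin n → ℕ} :
    σ ∈ syzygies S I ref ↔
      (σ.1 < conductor S ∧ σ.1 ∈ S ∧ σ.1 ≠ 0) ∧ σ.2 ≠ ref σ.1 ∧ σ.2 ∈ I σ.1 := by
  simp [syzygies, smallElements, and_assoc]

lemma mem_activeVectors {q j : ℕ} {e : Fin n → ℚ} :
    e ∈ activeVectors S I ref q j ↔ ∃ σ ∈ syzygies S I ref,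
      (σ.1 + j ∉ S ∧ σ.1 + j < q) ∧ syzygyVector ref σ = e := by
  simp [activeVectors, activeSyzygies, and_assoc]

lemma ref_mem (href : ∀ s, (I s).Nonempty → ref s ∈ I s) {σ : Σ _ : ℕ, Fin n → ℕ}
    (hσ : σ ∈ syzygies S I ref) : ref σ.1 ∈ I σ.1 :=
  href _ ⟨σ.2, (mem_syzygies.1 hσ).2.2⟩

lemma syzygyVector_injOn (hI : Unlinked k I) (href : ∀ s, (I s).Nonempty → ref s ∈ I s) :
    Set.InjOn (syzygyVector ref) (syzygies S I ref : Set (Σ _ : ℕ, Fin n → ℕ)) := by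
  rintro ⟨s, v⟩ hσ ⟨s', v'⟩ hσ' h
  obtain ⟨-, hne, hmem⟩ := mem_syzygies.1 hσ
  obtain ⟨-, hne', hmem'⟩ := mem_syzygies.1 hσ'
  obtain ⟨rfl, rfl⟩ := hI.eq_and_eq_of_diff_eq hmem (ref_mem href hσ) hne hmem' (ref_mem href hσ')
    hne' h
  rfl

lemma card_activeVectors (hI : Unlinked k I) (href : ∀ s, (I s).Nonempty → ref s ∈ I s)
    (q j : ℕ) : (activeVectors S I ref q j).card = (activeSyzygies S I ref q j).card :=
  Finset.card_image_of_injOn ((syzygyVector_injOn hI href).mono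
    (Finset.coe_subset.2 (Finset.filter_subset _ _)))

lemma syzygyVector_mem_columnVectors {σ : Σ _ : ℕ, Fin n → ℕ} (hσ : σ ∈ syzygies S I ref) :
    syzygyVector ref σ ∈ columnVectors I ref σ.1 :=
  Finset.mem_image_of_mem _ (Finset.mem_sigma.1 hσ).2

lemma exists_syzygy_of_mem_columnVectors {s : ℕ} (hs : s ∈ smallElements S) {e : Fin n → ℚ}
    (he : e ∈ columnVectors I ref s) :
    ∃ σ ∈ syzygies S I ref, σ.1 = s ∧ syzygyVector ref σ = e := by
  obtain ⟨v, hv, hve⟩ := Finset.mem_image.1 he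
  exact ⟨⟨s, v⟩, Finset.mem_sigma.2 ⟨hs, hv⟩, rfl, hve⟩

lemma activeVectors_subset_groundSet (q j : ℕ) :
    activeVectors S I ref q j ⊆ groundSet S I ref := by
  intro e he
  obtain ⟨σ, hσ, -, rfl⟩ := mem_activeVectors.1 he
  exact Finset.mem_biUnion.2 ⟨σ.1, (Finset.mem_sigma.1 hσ).1, syzygyVector_mem_columnVectors hσ⟩

lemma topElement_add_notMem (hI : Unlinked k I) (href : ∀ s, (I s).Nonempty → ref s ∈ I s)
    {q j : ℕ} {C : Finset (Fin n → ℚ)} (hne : C.Nonempty) (hC : C ⊆ activeVectors S I ref q j) :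
    topElement S I ref C + j ∉ S ∧ topElement S I ref C + j < q := by
  have hT : ((smallElements S).filter fun s => (columnVectors I ref s ∩ C).Nonempty).Nonempty := by
    obtain ⟨e, he⟩ := hne
    obtain ⟨σ, hσ, -, rfl⟩ := mem_activeVectors.1 (hC he)
    exact ⟨σ.1, Finset.mem_filter.2 ⟨(Finset.mem_sigma.1 hσ).1,
      _, Finset.mem_inter.2 ⟨syzygyVector_mem_columnVectors hσ, he⟩⟩⟩
  obtain ⟨s, hs, hsup⟩ := Finset.exists_mem_eq_sup _ hT id
  rw [show topElement S I ref C = s from hsup]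
  obtain ⟨hsmall, e, he⟩ := Finset.mem_filter.1 hs
  obtain ⟨hes, heC⟩ := Finset.mem_inter.1 he
  obtain ⟨σ, hσ, hactive, hσe⟩ := mem_activeVectors.1 (hC heC)
  obtain ⟨τ, hτ, rfl, hτe⟩ := exists_syzygy_of_mem_columnVectors hsmall hes
  rwa [syzygyVector_injOn hI href hτ hσ (hτe.trans hσe.symm)]

lemma card_activeVectors_le (hI : Unlinked k I) (href : ∀ s, (I s).Nonempty → ref s ∈ I s)
    (q j : ℕ) : (activeVectors S I ref q j).card ≤
      Module.finrank ℚ (activeSpan S I ref q j) + ((circuits S I ref).filter fun C =>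
        topElement S I ref C + j ∉ S ∧ topElement S I ref C + j < q).card := by
  refine (card_le_finrank_span_add_card_circuits (K := ℚ) _).trans
    (Nat.add_le_add_left (Finset.card_le_card fun C hC => ?_) _)
  obtain ⟨hCA, hC⟩ := Finset.mem_filter.1 hC
  have hCA := Finset.mem_powerset.1 hCA
  have hne : C.Nonempty := Finset.nonempty_iff_ne_empty.2 fun h => hC.1 (by simp [h])
  exact Finset.mem_filter.2 ⟨Finset.mem_filter.2 ⟨Finset.mem_powerset.2
    (hCA.trans (activeVectors_subset_groundSet q j)), hC⟩, topElement_add_notMem hI href hne hCA⟩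

lemma sum_rhoBelow_eq {α : Type*} (A : Finset α) (f : α → ℕ) (q : ℕ) :
    ∑ a ∈ A, rhoBelow S q (f a) =
      ∑ j ∈ Finset.Icc 1 q, (A.filter fun a => f a + j ∉ S ∧ f a + j < q).card := by
  simp_rw [← card_filter_Icc_eq_rhoBelow, Finset.card_filter]
  exact Finset.sum_comm

theorem sum_rhoBelow_le (hS : {r : ℕ | r ∉ S}.Finite) (hI : Unlinked k I)
    (href : ∀ s, (I s).Nonempty → ref s ∈ I s) (q : ℕ) :
    ∑ σ ∈ syzygies S I ref, rhoBelow S q σ.1 ≤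
      ∑ j ∈ Finset.Icc 1 q, Module.finrank ℚ (activeSpan S I ref q j) + syzygeticDefect S I ref :=
  calc ∑ σ ∈ syzygies S I ref, rhoBelow S q σ.1
      = ∑ j ∈ Finset.Icc 1 q, (activeVectors S I ref q j).card := by
        simp_rw [card_activeVectors hI href]
        exact sum_rhoBelow_eq _ _ _
    _ ≤ ∑ j ∈ Finset.Icc 1 q, (Module.finrank ℚ (activeSpan S I ref q j) +
          ((circuits S I ref).filter fun C =>
            topElement S I ref C + j ∉ S ∧ topElement S I ref C + j < q).card) :=
        Finset.sum_le_sum fun j _ => card_activeVectors_le hI href q j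
    _ = ∑ j ∈ Finset.Icc 1 q, Module.finrank ℚ (activeSpan S I ref q j) +
          ∑ C ∈ circuits S I ref, rhoBelow S q (topElement S I ref C) := by
        rw [Finset.sum_add_distrib, sum_rhoBelow_eq]
    _ ≤ _ := Nat.add_le_add_left (Finset.sum_le_sum fun C _ => rhoBelow_le_rho hS _ _) _

lemma phi_eq_card_erase {s : ℕ} (href : (I s).Nonempty → ref s ∈ I s) :
    phi I s = ((I s).erase (ref s)).card := by
  rcases (I s).eq_empty_or_nonempty with h | h
  · simp [phi, h]
  · rw [phi, Finset.card_erase_of_mem (href h)]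

lemma sum_phi_mul_rho_le (hS : {r : ℕ | r ∉ S}.Finite)
    (href : ∀ s, (I s).Nonempty → ref s ∈ I s) :
    ∑ s ∈ (Finset.Icc 1 (2 * genus S)).filter (· ∈ S), phi I s * rho S s ≤
      ∑ σ ∈ syzygies S I ref, rho S σ.1 := by
  have hsum : ∑ σ ∈ syzygies S I ref, rho S σ.1 = ∑ s ∈ smallElements S, phi I s * rho S s := by
    simp [syzygies, Finset.sum_sigma, phi_eq_card_erase (href _)]
  rw [hsum, ← Finset.sum_filter_ne_zero]
  refine Finset.sum_le_sum_of_subset fun s hs => ?_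
  simp only [Finset.mem_filter, Finset.mem_Icc] at hs
  obtain ⟨r, hsr, hr⟩ := Set.nonempty_of_ncard_ne_zero (right_ne_zero_of_mul hs.2)
  simp only [smallElements, Finset.mem_filter, Finset.mem_range]
  exact ⟨hsr.trans (lt_conductor hS hr), hs.1.2, by omega⟩

lemma card_syzygies_le (hI : Unlinked k I) (hk : ∀ i : Fin n, k i.succ ≠ 0)
    (href : ∀ s, (I s).Nonempty → ref s ∈ I s) :
    (syzygies S I ref).card ≤ ∑ᶠ s ∈ S, phi I s := by
  set b := (∑ i : Fin n, k i.succ) * (∑ i : Fin n, k i.succ)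
  have hfin : ∑ᶠ s ∈ S, phi I s =
      ∑ s ∈ (Finset.range (b + 1 + conductor S)).filter (· ∈ S), phi I s := by
    refine finsum_mem_eq_sum_of_inter_support_eq (s := (S : Set ℕ)) (phi I) ?_
    ext s
    simp only [Set.mem_inter_iff, SetLike.mem_coe, Function.mem_support, Finset.coe_filter,
      Finset.mem_range, Set.mem_ofPred_eq]
    refine ⟨fun h => ⟨⟨?_, h.1⟩, h.2⟩, fun h => ⟨h.1.2, h.2⟩⟩
    by_contra hs
    exact h.2 (hI.phi_eq_zero hk (by omega))
  rw [hfin, syzygies, Finset.card_sigma]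
  simp_rw [← phi_eq_card_erase (href _)]
  refine Finset.sum_le_sum_of_subset fun s hs => ?_
  simp only [smallElements, Finset.mem_filter, Finset.mem_range] at hs ⊢
  exact ⟨by omega, hs.2.1⟩

end Syzygies

section Cutoff

variable {n : ℕ} {S : AddSubmonoid ℕ} {k : Fin (n + 1) → ℕ} {I : ℕ → Finset (Fin n → ℕ)}
  {ref : ℕ → Fin n → ℕ}

lemma toFinset_take_sort {α : Type*} [LinearOrder α] (s : Finset α) {m : ℕ}
    (hm : m < s.sort.length) : (s.sort.take m).toFinset = s.filter (· < s.sort[m]) := by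
  have hmono : StrictMono fun i : Fin s.sort.length => s.sort[i] := s.sortedLT_sort.strictMono_get
  ext x
  rw [List.mem_toFinset, Finset.mem_filter, List.mem_take_iff_getElem,
    ← Finset.mem_sort (· ≤ ·), List.mem_iff_getElem]
  constructor
  · rintro ⟨i, hi, rfl⟩
    have hi := lt_min_iff.1 hi
    exact ⟨⟨i, hi.2, rfl⟩, @hmono ⟨i, hi.2⟩ ⟨m, hm⟩ hi.1⟩
  · rintro ⟨⟨i, hi, rfl⟩, h⟩
    have : i < m := (hmono.lt_iff_lt (a := ⟨i, hi⟩) (b := ⟨m, hm⟩)).1 h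
    exact ⟨i, lt_min this hi, rfl⟩

lemma sum_map_take_sort {α β : Type*} [LinearOrder α] [AddCommMonoid β] (s : Finset α) (f : α → β)
    (m : ℕ) : ((s.sort.take m).map f).sum = ∑ x ∈ (s.sort.take m).toFinset, f x :=
  (List.sum_toFinset _ ((Finset.sort_nodup _ _).sublist (List.take_sublist _ _))).symm

lemma card_filter_lt_getElem_sort {α : Type*} [LinearOrder α] (s : Finset α) {m : ℕ}
    (hm : m < s.sort.length) : (s.filter (· < s.sort[m])).card = m := by
  rw [← toFinset_take_sort s hm, List.toFinset_card_of_nodup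
    ((Finset.sort_nodup _ _).sublist (List.take_sublist _ _)), List.length_take, min_eq_left hm.le]

/-- The missing generators less than a cutoff `q`: those whose coefficients enter the dimension
count when only the conditions at the gaps below `q` are imposed. -/
noncomputable def generatorsBelow (S : AddSubmonoid ℕ) (k : Fin (n + 1) → ℕ) (q : ℕ) : Finset ℕ :=
  (missingGenerators S k).filter (· < q)

/-- If `φ` sums to at least the number of missing generators, take `q` to be the conductor, beyond
which there are no gaps. Otherwise take `q` to be the first missing generator that is not counted
in the correction. -/
lemma exists_generatorCorrection_eq (hS : {r : ℕ | r ∉ S}.Finite) (k : Fin (n + 1) → ℕ)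
    (I : ℕ → Finset (Fin n → ℕ)) :
    ∃ q ∈ S, q ≤ conductor S ∧ generatorCorrection S k I =
      ∑ s ∈ generatorsBelow S k q, rhoBelow S q s +
        (∑ᶠ s ∈ S, phi I s) * rho S q := by
  set m := ∑ᶠ s ∈ S, phi I s
  set gens := missingGenerators S k with hgens
  simp only [generatorsBelow]
  rw [generatorCorrection, sum_map_take_sort, correctionLength, ← hgens]
  rcases le_or_gt gens.card m with hm | hm
  · have hc := mem_of_conductor_le hS le_rfl
    have hfilter : gens.filter (· < conductor S) = gens := Finset.filter_true_of_mem fun s hs =>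
      Finset.mem_range.1 (Finset.mem_filter.1 hs).1
    refine ⟨conductor S, hc, le_rfl, ?_⟩
    rw [rho_conductor hS, mul_zero, add_zero, hfilter, min_eq_left hm, ← Finset.length_sort (· ≤ ·),
      List.take_length, Finset.sort_toFinset]
    refine Finset.sum_congr rfl fun s hs => ?_
    rw [← hfilter] at hs
    rw [rho_eq_rhoBelow_add_rho hS hc (Finset.mem_filter.1 hs).2.le, rho_conductor hS, add_zero]
  · have hlen : m < gens.sort.length := hm.trans_eq (Finset.length_sort _).symm
    obtain ⟨hqc, ⟨hq, -⟩, -⟩ :=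
      Finset.mem_filter.1 ((Finset.mem_sort (· ≤ ·)).1 (List.getElem_mem hlen))
    refine ⟨gens.sort[m], hq, (Finset.mem_range.1 hqc).le, ?_⟩
    rw [min_eq_right hm.le, toFinset_take_sort gens hlen, Finset.sum_congr rfl fun s hs =>
      rho_eq_rhoBelow_add_rho hS hq (Finset.mem_filter.1 hs).2.le, Finset.sum_add_distrib,
      Finset.sum_const, card_filter_lt_getElem_sort gens hlen, smul_eq_mul]

/-- Imposing only the conditions at the gaps below `q` loses at most `(∑ φ) ρ(q)` conditions, and
this is gained back from the corrections for the missing generators. -/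
theorem exists_cutoff (hS : {r : ℕ | r ∉ S}.Finite) (hI : Unlinked k I)
    (hk : ∀ i : Fin n, k i.succ ≠ 0) (href : ∀ s, (I s).Nonempty → ref s ∈ I s) :
    ∃ q ≤ conductor S,
      ∑ s ∈ (Finset.Icc 1 (2 * genus S)).filter (· ∈ S), phi I s * rho S s +
        ∑ s ∈ generatorsBelow S k q, rhoBelow S q s ≤
      ∑ σ ∈ syzygies S I ref, rhoBelow S q σ.1 + generatorCorrection S k I := by
  obtain ⟨q, hq, hqc, hcorr⟩ := exists_generatorCorrection_eq hS k I
  have hsum : ∑ σ ∈ syzygies S I ref, rho S σ.1 ≤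
      ∑ σ ∈ syzygies S I ref, rhoBelow S q σ.1 + (∑ᶠ s ∈ S, phi I s) * rho S q :=
    calc ∑ σ ∈ syzygies S I ref, rho S σ.1
        ≤ ∑ σ ∈ syzygies S I ref, (rhoBelow S q σ.1 + rho S q) :=
          Finset.sum_le_sum fun σ _ => rho_le_rhoBelow_add_rho hS hq σ.1
      _ = ∑ σ ∈ syzygies S I ref, rhoBelow S q σ.1 + (syzygies S I ref).card * rho S q := by
          rw [Finset.sum_add_distrib, Finset.sum_const, smul_eq_mul]
      _ ≤ _ := by
          gcongr
          exact card_syzygies_le hI hk href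
  have := sum_phi_mul_rho_le hS href
  exact ⟨q, hqc, by omega⟩

end Cutoff

/-! ### Value semigroups in affine charts -/

section SubmodulePowers

variable {R A B : Type*} [CommRing R] [CommRing A] [CommRing B] [Algebra R A] [Algebra R B]

lemma pow_le_map_pow (φ : A →ₐ[R] B) (u : B) {V : Submodule R B} {W : Submodule R A}
    (h : V ≤ W.map (LinearMap.mulLeft R u ∘ₗ φ.toLinearMap)) (e : ℕ) :
    V ^ e ≤ (W ^ e).map (LinearMap.mulLeft R (u ^ e) ∘ₗ φ.toLinearMap) := by
  induction e with
  | zero =>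
    refine Submodule.one_le.2 ⟨1, Submodule.one_le.1 le_rfl, ?_⟩
    simp
  | succ e ih =>
    rw [pow_succ, pow_succ]
    refine Submodule.mul_le.2 fun x hx y hy => ?_
    obtain ⟨x', hx', rfl⟩ := ih hx
    obtain ⟨y', hy', rfl⟩ := h hy
    refine ⟨x' * y', Submodule.mul_mem_mul hx' hy', ?_⟩
    simp only [LinearMap.comp_apply, AlgHom.toLinearMap_apply, LinearMap.mulLeft_apply, map_mul]
    ring

lemma pow_degree_mul_prod_mem_pow {σ : Type*} {V : Submodule R A} {u : A} {x : σ → A}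
    (hx : ∀ i, u * x i ∈ V) (m : σ →₀ ℕ) :
    u ^ m.degree * (m.prod fun i l => x i ^ l) ∈ V ^ m.degree := by
  induction m using Finsupp.induction_linear with
  | zero => simpa using Submodule.one_le.1 (le_refl (1 : Submodule R A))
  | add m m' hm hm' =>
    rw [map_add, pow_add, pow_add, Finsupp.prod_add_index' (fun _ => pow_zero _)
      (fun _ _ _ => pow_add _ _ _), mul_mul_mul_comm]
    exact Submodule.mul_mem_mul hm hm'
  | single i l =>
    rw [Finsupp.prod_single_index (h := fun i l => x i ^ l) (pow_zero _), Finsupp.degree_single,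
      ← mul_pow]
    exact Submodule.pow_mem_pow _ (hx i) _

lemma pow_mul_aeval_mem_pow {σ : Type*} {V : Submodule R A} {u : A} {x : σ → A} (hu : u ∈ V)
    (hx : ∀ i, u * x i ∈ V) {p : MvPolynomial σ R} {e : ℕ} (hp : p.totalDegree ≤ e) :
    u ^ e * MvPolynomial.aeval x p ∈ V ^ e := by
  rw [MvPolynomial.aeval_def, MvPolynomial.eval₂_eq, Finset.mul_sum]
  refine Submodule.sum_mem _ fun m hm => ?_
  have hme : m.degree ≤ e := (MvPolynomial.le_totalDegree hm).trans hp
  obtain ⟨l, rfl⟩ := Nat.exists_eq_add_of_le' hme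
  have hmon : u ^ l * (u ^ m.degree * m.prod fun i l => x i ^ l) ∈ V ^ (l + m.degree) :=
    pow_add V l _ ▸ Submodule.mul_mem_mul (Submodule.pow_mem_pow V hu l)
      (pow_degree_mul_prod_mem_pow hx m)
  rw [mul_left_comm, ← Algebra.smul_def]
  refine Submodule.smul_mem _ _ ?_
  rwa [pow_add u, mul_assoc]

end SubmodulePowers

section Order

variable {R : Type*} [CommRing R]

lemma order_eq_of_lt_order_sub {f g : R⟦X⟧} (h : f.order < (f - g).order) :
    g.order = f.order := by
  rw [← sub_sub_cancel f g, sub_eq_add_neg f (f - g),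
    PowerSeries.order_add_of_order_ne _ _ (by rw [PowerSeries.order_neg]; exact h.ne),
    PowerSeries.order_neg, inf_eq_left.2 h.le]

lemma order_unit_mul [IsDomain R] {u : R⟦X⟧} (hu : IsUnit u) (f : R⟦X⟧) :
    (u * f).order = f.order := by
  rw [PowerSeries.order_mul, PowerSeries.order_zero_of_unit hu, zero_add]

lemma exists_order_aeval_eq {σ : Type*} [Finite σ] {x : σ → R⟦X⟧}
    (hx : ∀ i, PowerSeries.constantCoeff (x i) = 0) {G : MvPowerSeries σ R} {s : ℕ}
    (hG : PowerSeries.order (MvPowerSeries.subst x G : R⟦X⟧) = (s : ℕ∞)) :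
    ∃ p : MvPolynomial σ R, p.totalDegree ≤ s ∧ (MvPolynomial.aeval x p).order = (s : ℕ∞) := by
  have hs : MvPowerSeries.HasSubst x := MvPowerSeries.hasSubst_of_constantCoeff_zero hx
  set p := MvPowerSeries.truncTotal (s + 1) G
  refine ⟨p, Nat.lt_succ_iff.1 (MvPowerSeries.totalDegree_truncTotal_lt _ (Nat.succ_ne_zero s)), ?_⟩
  have htail : ((s + 1 : ℕ) : ℕ∞) ≤ (G - (p : MvPowerSeries σ R)).order := by
    refine MvPowerSeries.nat_le_order fun m hm => ?_
    rw [map_sub, MvPolynomial.coeff_coe, MvPowerSeries.coeff_truncTotal _ hm, sub_self]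
  have hmin : (1 : ℕ∞) ≤ ⨅ i, MvPowerSeries.order (x i) :=
    le_iInf fun i => MvPowerSeries.one_le_order_iff_constCoeff_eq_zero.2 (hx i)
  have hsub : ((s + 1 : ℕ) : ℕ∞) ≤ PowerSeries.order
      (MvPowerSeries.subst x (G - (p : MvPowerSeries σ R)) : R⟦X⟧) := by
    rw [PowerSeries.order_eq_order]
    exact ((one_mul _).symm.trans_le (mul_le_mul' hmin htail)).trans
      (MvPowerSeries.le_order_subst hs _)
  rw [MvPowerSeries.subst_sub hs, MvPowerSeries.subst_coe p] at hsub
  rw [← hG]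
  refine order_eq_of_lt_order_sub (lt_of_lt_of_le ?_ hsub)
  rw [hG]
  exact_mod_cast s.lt_succ_self

lemma constantCoeff_aeval {τ : R⟦X⟧} (hτ : PowerSeries.constantCoeff τ = 0) (χ : Polynomial R) :
    PowerSeries.constantCoeff (Polynomial.aeval τ χ) = χ.coeff 0 := by
  have hid : (PowerSeries.constantCoeff (R := R)).comp (algebraMap R R⟦X⟧) = RingHom.id R := by
    ext c
    exact PowerSeries.constantCoeff_C c
  rw [Polynomial.aeval_def, Polynomial.hom_eval₂, hτ, hid, Polynomial.eval₂_id,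
    ← Polynomial.coeff_zero_eq_eval_zero]

lemma order_aeval_of_order_eq_one [IsDomain R] {τ : R⟦X⟧} (hτ : τ.order = 1)
    (ψ : Polynomial R) : (Polynomial.aeval τ ψ).order = (ψ : R⟦X⟧).order := by
  by_cases hψ : ψ = 0
  · simp [hψ]
  obtain ⟨χ, hχ, hχ0⟩ := Polynomial.exists_eq_pow_rootMultiplicity_mul_and_not_dvd ψ hψ 0
  rw [map_zero, sub_zero] at hχ hχ0
  rw [Polynomial.X_dvd_iff] at hχ0
  have hτ0 : PowerSeries.constantCoeff τ = 0 := by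
    rw [← PowerSeries.one_le_order_iff_constCoeff_eq_zero, hτ]
  have horder : ∀ {f : R⟦X⟧}, PowerSeries.constantCoeff f ≠ 0 → f.order = 0 := fun hf =>
    (PowerSeries.order_eq_nat (n := 0)).2 ⟨by simpa using hf, by simp⟩
  have hχ1 : (χ : R⟦X⟧).order = 0 := horder (by simpa using hχ0)
  have hχ2 : (Polynomial.aeval τ χ).order = 0 := horder (by rwa [constantCoeff_aeval hτ0])
  rw [hχ, map_mul, map_pow, Polynomial.aeval_X, Polynomial.coe_mul, Polynomial.coe_pow,
    Polynomial.coe_X, PowerSeries.order_mul, PowerSeries.order_mul, hχ1, hχ2, PowerSeries.order_pow,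
    PowerSeries.order_pow, hτ, PowerSeries.order_X]

end Order

section Values

variable {n d : ℕ}

lemma map_evalForm {A B : Type} [CommRing A] [CommRing B] [Algebra ℂ A] [Algebra ℂ B]
    (f : A →ₐ[ℂ] B) (a : Fin (n + 1) × Fin (d + 1) → ℂ) (i : Fin (n + 1)) (u v : A) :
    f (evalForm a i u v) = evalForm a i (f u) (f v) := by
  simp [evalForm]

lemma evalForm_mul {A : Type} [CommRing A] [Algebra ℂ A]
    (a : Fin (n + 1) × Fin (d + 1) → ℂ) (i : Fin (n + 1)) (c u v : A) :
    evalForm a i (c * u) (c * v) = c ^ d * evalForm a i u v := by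
  simp only [evalForm, Finset.mul_sum]
  refine Finset.sum_congr rfl fun j _ => ?_
  rw [← pow_mul_pow_sub c (Nat.lt_succ_iff.1 j.2), mul_pow, mul_pow]
  ring

/-- The space of linear combinations of the forms, as functions of a local parameter at `P`. -/
def sectionSpace (a : Fin (n + 1) × Fin (d + 1) → ℂ) (P Q : Fin 2 → ℂ) : Submodule ℂ ℂ⟦X⟧ :=
  Submodule.span ℂ (Set.range (localSection a P Q))

lemma constantCoeff_localSection (a : Fin (n + 1) × Fin (d + 1) → ℂ) (P Q : Fin 2 → ℂ)
    (i : Fin (n + 1)) :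
    PowerSeries.constantCoeff (localSection a P Q i) = evalForm a i (P 0) (P 1) := by
  simp [localSection, evalForm]

section Chart

variable {a : Fin (n + 1) × Fin (d + 1) → ℂ} {P Q : Fin 2 → ℂ} {j : Fin (n + 1)}

lemma isUnit_localSection (hj : evalForm a j (P 0) (P 1) ≠ 0) : IsUnit (localSection a P Q j) := by
  rwa [PowerSeries.isUnit_iff_constantCoeff, constantCoeff_localSection, isUnit_iff_ne_zero]

lemma constantCoeff_localCoordinate (i : Fin (n + 1)) :
    PowerSeries.constantCoeff (localCoordinate a P Q j i) = 0 := by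
  simp [localCoordinate]

lemma exists_localSection_eq_mul (hj : evalForm a j (P 0) (P 1) ≠ 0) (i : Fin (n + 1)) :
    ∃ c : ℂ, localSection a P Q i =
      localSection a P Q j * (localCoordinate a P Q j i + PowerSeries.C c) := by
  refine ⟨PowerSeries.constantCoeff (localSection a P Q i * (localSection a P Q j)⁻¹), ?_⟩
  rw [localCoordinate, sub_add_cancel, mul_left_comm, PowerSeries.mul_inv_cancel _
    (by rwa [constantCoeff_localSection]), mul_one]

lemma exists_eq_pow_mul_subst (hj : evalForm a j (P 0) (P 1) ≠ 0) {e : ℕ} {h : ℂ⟦X⟧}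
    (hh : h ∈ sectionSpace a P Q ^ e) :
    ∃ G : MvPowerSeries (Fin (n + 1)) ℂ,
      h = localSection a P Q j ^ e * (MvPowerSeries.subst (localCoordinate a P Q j) G : ℂ⟦X⟧) := by
  have hs : MvPowerSeries.HasSubst (localCoordinate a P Q j) :=
    MvPowerSeries.hasSubst_of_constantCoeff_zero constantCoeff_localCoordinate
  let φ : MvPowerSeries (Fin (n + 1)) ℂ →ₐ[ℂ] ℂ⟦X⟧ := MvPowerSeries.substAlgHom hs
  have hspan : sectionSpace a P Q ≤ (⊤ : Submodule ℂ (MvPowerSeries (Fin (n + 1)) ℂ)).map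
      (LinearMap.mulLeft ℂ (localSection a P Q j) ∘ₗ φ.toLinearMap) := by
    refine Submodule.span_le.2 ?_
    rintro _ ⟨i, rfl⟩
    obtain ⟨c, hc⟩ := exists_localSection_eq_mul (Q := Q) hj i
    refine ⟨MvPowerSeries.X i + MvPowerSeries.C c, trivial, ?_⟩
    have hX : φ (MvPowerSeries.X i) = localCoordinate a P Q j i := MvPowerSeries.substAlgHom_X hs i
    have hC : φ (MvPowerSeries.C c) = PowerSeries.C c := φ.commutes c
    rw [LinearMap.comp_apply, AlgHom.toLinearMap_apply, LinearMap.mulLeft_apply, map_add, hX, hC,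
      hc]
  obtain ⟨G, -, rfl⟩ := pow_le_map_pow φ _ hspan e hh
  refine ⟨G, ?_⟩
  rw [← MvPowerSeries.coe_substAlgHom hs]
  rfl

lemma exists_order_eq_of_order_subst_eq (hj : evalForm a j (P 0) (P 1) ≠ 0) {s : ℕ}
    {G : MvPowerSeries (Fin (n + 1)) ℂ}
    (hG : PowerSeries.order (MvPowerSeries.subst (localCoordinate a P Q j) G : ℂ⟦X⟧) = (s : ℕ∞)) :
    ∃ h ∈ sectionSpace a P Q ^ s, h.order = (s : ℕ∞) := by
  obtain ⟨p, hp, hs⟩ := exists_order_aeval_eq constantCoeff_localCoordinate hG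
  have hsection : ∀ i, localSection a P Q i ∈ sectionSpace a P Q := fun i =>
    Submodule.subset_span ⟨i, rfl⟩
  refine ⟨_, pow_mul_aeval_mem_pow (hsection j) (fun i => ?_) hp,
    (order_unit_mul ((isUnit_localSection hj).pow s) _).trans hs⟩
  obtain ⟨c, hc⟩ := exists_localSection_eq_mul (Q := Q) hj i
  rw [← sub_eq_of_eq_add (hc.trans (mul_add _ _ _)), mul_comm, ← PowerSeries.smul_eq_C_mul]
  exact Submodule.sub_mem _ (hsection i) (Submodule.smul_mem _ _ (hsection j))

end Chart

/-- The `i`-th form along `t ↦ P + t Q`, as a polynomial in `t`; unlike a power series, it can be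
composed with a change of parameter by evaluation. -/
noncomputable def localPolynomial (a : Fin (n + 1) × Fin (d + 1) → ℂ) (P Q : Fin 2 → ℂ)
    (i : Fin (n + 1)) : Polynomial ℂ :=
  evalForm a i (Polynomial.C (P 0) + Polynomial.C (Q 0) * Polynomial.X)
    (Polynomial.C (P 1) + Polynomial.C (Q 1) * Polynomial.X)

lemma coe_localPolynomial (a : Fin (n + 1) × Fin (d + 1) → ℂ) (P Q : Fin 2 → ℂ) (i : Fin (n + 1)) :
    (localPolynomial a P Q i : ℂ⟦X⟧) = localSection a P Q i := by
  have hcoe : ∀ p : Polynomial ℂ, Polynomial.coeToPowerSeries.algHom (R := ℂ) ℂ p = p := by simp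
  have hpoint : ∀ l, ((Polynomial.C (P l) + Polynomial.C (Q l) * Polynomial.X : Polynomial ℂ) :
      ℂ⟦X⟧) = PowerSeries.C (P l) + PowerSeries.C (Q l) * PowerSeries.X := by simp
  rw [localPolynomial, ← hcoe, map_evalForm, hcoe, hcoe, hpoint, hpoint, localSection]

lemma map_span_localPolynomial (a : Fin (n + 1) × Fin (d + 1) → ℂ) (P Q : Fin 2 → ℂ) :
    (Submodule.span ℂ (Set.range (localPolynomial a P Q))).map
      (Polynomial.coeToPowerSeries.algHom (R := ℂ) ℂ).toLinearMap = sectionSpace a P Q := by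
  rw [Submodule.map_span, ← Set.range_comp, sectionSpace]
  congr 2
  funext i
  simp [coe_localPolynomial]

lemma exists_eq_smul_add_smul {P Q Q' : Fin 2 → ℂ} (hQ : Indep P Q) (hQ' : Indep P Q') :
    ∃ α β : ℂ, β ≠ 0 ∧ Q' = α • P + β • Q := by
  have hD : P 0 * Q 1 - P 1 * Q 0 ≠ 0 := hQ
  refine ⟨(Q' 0 * Q 1 - Q' 1 * Q 0) / (P 0 * Q 1 - P 1 * Q 0),
    (P 0 * Q' 1 - P 1 * Q' 0) / (P 0 * Q 1 - P 1 * Q 0), div_ne_zero hQ' hD, ?_⟩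
  ext l
  fin_cases l <;>
  · simp only [Pi.add_apply, Pi.smul_apply, smul_eq_mul, Fin.zero_eta, Fin.mk_one]
    rw [div_mul_eq_mul_div, div_mul_eq_mul_div, ← add_div, eq_div_iff hD]
    ring

/-- If `Q' = α P + β Q`, then `P + t Q' = (1 + α t) (P + τ Q)` for `τ = β t / (1 + α t)`. -/
lemma exists_localSection_eq_pow_mul_aeval (a : Fin (n + 1) × Fin (d + 1) → ℂ) {P Q Q' : Fin 2 → ℂ}
    (hQ : Indep P Q) (hQ' : Indep P Q') :
    ∃ u τ : ℂ⟦X⟧, IsUnit u ∧ τ.order = 1 ∧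
      ∀ i, localSection a P Q' i = u ^ d * Polynomial.aeval τ (localPolynomial a P Q i) := by
  obtain ⟨α, β, hβ, rfl⟩ := exists_eq_smul_add_smul hQ hQ'
  set u : ℂ⟦X⟧ := 1 + PowerSeries.C α * PowerSeries.X with hu
  have hmul : u * u⁻¹ = 1 := PowerSeries.mul_inv_cancel _ (by simp [hu])
  have hinv : IsUnit u⁻¹ := IsUnit.of_mul_eq_one _ ((mul_comm _ _).trans hmul)
  have hC : IsUnit (PowerSeries.C β) := PowerSeries.isUnit_iff_constantCoeff.2 (by simpa using hβ)
  refine ⟨u, u⁻¹ * (PowerSeries.C β * PowerSeries.X), IsUnit.of_mul_eq_one _ hmul, ?_, fun i => ?_⟩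
  · rw [order_unit_mul hinv, order_unit_mul hC, PowerSeries.order_X]
  · have hpoint : ∀ l, PowerSeries.C (P l) + PowerSeries.C (α * P l + β * Q l) * PowerSeries.X =
        u * (PowerSeries.C (P l) +
          PowerSeries.C (Q l) * (u⁻¹ * (PowerSeries.C β * PowerSeries.X))) := by
      intro l
      rw [mul_add, mul_left_comm (PowerSeries.C (Q l)), ← mul_assoc u u⁻¹, hmul, hu]
      simp only [map_add, map_mul]
      ring
    rw [localPolynomial, map_evalForm, ← evalForm_mul, localSection]
    simp only [Pi.add_apply, Pi.smul_apply, smul_eq_mul]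
    rw [hpoint, hpoint]
    simp only [map_add, map_mul, Polynomial.aeval_C, Polynomial.aeval_X]
    rfl

lemma exists_mem_pow_order_eq (a : Fin (n + 1) × Fin (d + 1) → ℂ) {P Q Q' : Fin 2 → ℂ}
    (hQ : Indep P Q) (hQ' : Indep P Q') {e : ℕ} {h : ℂ⟦X⟧} (hh : h ∈ sectionSpace a P Q' ^ e) :
    ∃ h' ∈ sectionSpace a P Q ^ e, h'.order = h.order := by
  obtain ⟨u, τ, hu, hτ, hsection⟩ := exists_localSection_eq_pow_mul_aeval a hQ hQ'
  have hspan : sectionSpace a P Q' ≤ (Submodule.span ℂ (Set.range (localPolynomial a P Q))).map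
      (LinearMap.mulLeft ℂ (u ^ d) ∘ₗ (Polynomial.aeval τ).toLinearMap) := by
    refine Submodule.span_le.2 ?_
    rintro _ ⟨i, rfl⟩
    exact ⟨_, Submodule.subset_span ⟨i, rfl⟩, (hsection i).symm⟩
  obtain ⟨ψ, hψ, rfl⟩ := pow_le_map_pow _ _ hspan e hh
  refine ⟨ψ, ?_, ?_⟩
  · rw [← map_span_localPolynomial, ← Submodule.map_pow]
    exact ⟨ψ, hψ, rfl⟩
  · exact ((order_unit_mul ((hu.pow d).pow e) _).trans (order_aeval_of_order_eq_one hτ ψ)).symm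

theorem mem_valueSet_iff {a : Fin (n + 1) × Fin (d + 1) → ℂ} {P Q : Fin 2 → ℂ} (hQ : Indep P Q)
    (ha : ∃ j, evalForm a j (P 0) (P 1) ≠ 0) (s : ℕ) :
    s ∈ valueSet a P ↔ ∃ e, ∃ h ∈ sectionSpace a P Q ^ e, h.order = (s : ℕ∞) := by
  constructor
  · rintro ⟨Q', j, G, hQ', hj, hG⟩
    obtain ⟨h, hh, hs⟩ := exists_order_eq_of_order_subst_eq hj hG
    obtain ⟨h', hh', hs'⟩ := exists_mem_pow_order_eq a hQ hQ' hh
    exact ⟨s, h', hh', hs'.trans hs⟩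
  · rintro ⟨e, h, hh, hs⟩
    obtain ⟨j, hj⟩ := ha
    obtain ⟨G, rfl⟩ := exists_eq_pow_mul_subst hj hh
    exact ⟨Q, j, G, hQ, hj, (order_unit_mul ((isUnit_localSection hj).pow e) _).symm.trans hs⟩

theorem mem_vanishingOrders_iff {a : Fin (n + 1) × Fin (d + 1) → ℂ} {P Q : Fin 2 → ℂ}
    (hQ : Indep P Q) (s : ℕ) :
    s ∈ vanishingOrders a P ↔ ∃ h ∈ sectionSpace a P Q, h.order = (s : ℕ∞) := by
  constructor
  · rintro ⟨Q', c, hQ', hs⟩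
    have hmem : ∑ i, c i • localSection a P Q' i ∈ sectionSpace a P Q' ^ 1 :=
      (pow_one (sectionSpace a P Q')).symm ▸
        (Submodule.mem_span_range_iff_exists_fun ℂ).2 ⟨c, rfl⟩
    obtain ⟨h, hh, hs'⟩ := exists_mem_pow_order_eq a hQ hQ' hmem
    exact ⟨h, by rwa [pow_one] at hh, hs'.trans hs⟩
  · rintro ⟨h, hh, hs⟩
    obtain ⟨c, rfl⟩ := (Submodule.mem_span_range_iff_exists_fun ℂ).1 hh
    exact ⟨Q, c, hQ, hs⟩

/-- The numbering of the monomials in one of the two standard charts of the projective line; the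
charts are exchanged by reversing the coefficients. -/
def chartPerm (d : ℕ) (ε : Bool) : Equiv.Perm (Fin (d + 1)) :=
  if ε then Fin.revPerm else Equiv.refl _

/-- The `i`-th dehomogenized form in a standard chart, expanded at the point `p`. -/
noncomputable def chartSection (ε : Bool) (a : Fin (n + 1) × Fin (d + 1) → ℂ) (p : ℂ)
    (i : Fin (n + 1)) : ℂ⟦X⟧ :=
  ∑ j : Fin (d + 1), PowerSeries.C (a (i, chartPerm d ε j)) *
    (PowerSeries.C p + PowerSeries.X) ^ (j : ℕ)

lemma localSection_eq_smul_chartSection_true (a : Fin (n + 1) × Fin (d + 1) → ℂ)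
    {P : Fin 2 → ℂ} (hP : P 1 = 0) (i : Fin (n + 1)) :
    localSection a P ![0, P 0] i = P 0 ^ d • chartSection true a 0 i := by
  have hmul := evalForm_mul a i (PowerSeries.C (P 0)) 1 PowerSeries.X
  rw [PowerSeries.smul_eq_C_mul, map_pow]
  convert hmul using 2
  · simp [localSection, hP]
  · simp only [evalForm, chartSection, chartPerm, if_true]
    rw [← Equiv.sum_comp Fin.revPerm]
    refine Finset.sum_congr rfl fun j _ => ?_
    simp [Fin.val_rev]

lemma localSection_eq_smul_chartSection_false (a : Fin (n + 1) × Fin (d + 1) → ℂ)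
    {P : Fin 2 → ℂ} (hP : P 1 ≠ 0) (i : Fin (n + 1)) :
    localSection a P ![P 1, 0] i = P 1 ^ d • chartSection false a (P 0 / P 1) i := by
  have hmul := evalForm_mul a i (PowerSeries.C (P 1)) (PowerSeries.C (P 0 / P 1) + PowerSeries.X) 1
  rw [PowerSeries.smul_eq_C_mul, map_pow]
  convert hmul using 2
  · rw [mul_add, ← map_mul, mul_div_cancel₀ _ hP]
    simp [localSection]
  · simp [evalForm, chartSection, chartPerm]

lemma exists_chart (a : Fin (n + 1) × Fin (d + 1) → ℂ) {P : Fin 2 → ℂ} (hP : P ≠ 0) :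
    ∃ (ε : Bool) (p : ℂ) (Q : Fin 2 → ℂ), Indep P Q ∧
      sectionSpace a P Q = Submodule.span ℂ (Set.range (chartSection ε a p)) := by
  have hspan : ∀ {F F' : Fin (n + 1) → ℂ⟦X⟧} {μ : ℂ}, μ ≠ 0 → (∀ i, F i = μ • F' i) →
      Submodule.span ℂ (Set.range F) = Submodule.span ℂ (Set.range F') := fun {F F' μ} hμ h => by
    rw [funext h, Set.range_smul, Submodule.span_smul_eq_of_isUnit _ _ hμ.isUnit]
  by_cases hP1 : P 1 = 0
  · have hP0 : P 0 ≠ 0 := fun h => hP (by ext i; fin_cases i <;> simp [h, hP1])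
    exact ⟨true, 0, ![0, P 0], by simp [Indep, hP0],
      hspan (pow_ne_zero _ hP0) (localSection_eq_smul_chartSection_true a hP1)⟩
  · exact ⟨false, P 0 / P 1, ![P 1, 0], by simp [Indep, hP1],
      hspan (pow_ne_zero _ hP1) (localSection_eq_smul_chartSection_false a hP1)⟩

end Values

/-! ### Normal forms -/

section Monic

variable {R : Type*} [CommSemiring R]

/-- `h` is a power series of order `s` with leading coefficient `1`. -/
def IsMonicOfOrder (h : R⟦X⟧) (s : ℕ) : Prop :=
  (∀ r < s, PowerSeries.coeff r h = 0) ∧ PowerSeries.coeff s h = 1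

lemma isMonicOfOrder_iff_exists {h : R⟦X⟧} {s : ℕ} :
    IsMonicOfOrder h s ↔
      ∃ u : R⟦X⟧, PowerSeries.constantCoeff u = 1 ∧ h = PowerSeries.X ^ s * u := by
  have hcoeff : ∀ u : R⟦X⟧, PowerSeries.coeff s (PowerSeries.X ^ s * u) =
      PowerSeries.constantCoeff u := fun u => by simp [PowerSeries.coeff_X_pow_mul']
  constructor
  · rintro ⟨hlt, hs⟩
    obtain ⟨u, rfl⟩ := PowerSeries.X_pow_dvd_iff.2 hlt
    exact ⟨u, (hcoeff u).symm.trans hs, rfl⟩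
  · rintro ⟨u, hu, rfl⟩
    exact ⟨PowerSeries.X_pow_dvd_iff.1 (dvd_mul_right _ _), (hcoeff u).trans hu⟩

lemma prod_X_pow_mul_pow {ι : Type*} [Fintype ι] (s m : ι → ℕ) (u : ι → R⟦X⟧) :
    ∏ i, (PowerSeries.X ^ s i * u i) ^ m i =
      PowerSeries.X ^ (∑ i, m i * s i) * ∏ i, u i ^ m i := by
  rw [← Finset.prod_pow_eq_pow_sum, ← Finset.prod_mul_distrib]
  refine Finset.prod_congr rfl fun i _ => ?_
  rw [mul_pow, ← pow_mul, mul_comm (s i)]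

namespace IsMonicOfOrder

lemma constantCoeff_eq_one {x : R⟦X⟧} (hx : IsMonicOfOrder x 0) :
    PowerSeries.constantCoeff x = 1 := by
  rw [← PowerSeries.coeff_zero_eq_constantCoeff_apply, hx.2]

lemma prod_pow {ι : Type*} [Fintype ι] {x : ι → R⟦X⟧} {s : ι → ℕ}
    (hx : ∀ i, IsMonicOfOrder (x i) (s i)) (m : ι → ℕ) :
    IsMonicOfOrder (∏ i, x i ^ m i) (∑ i, m i * s i) := by
  choose u hu hxu using fun i => isMonicOfOrder_iff_exists.1 (hx i)
  refine isMonicOfOrder_iff_exists.2 ⟨∏ i, u i ^ m i, ?_, ?_⟩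
  · simp [map_prod, hu]
  · rw [funext hxu, prod_X_pow_mul_pow]

lemma mul_of_constantCoeff_eq_one {x y : R⟦X⟧} {s : ℕ} (hx : IsMonicOfOrder x s)
    (hy : PowerSeries.constantCoeff y = 1) : IsMonicOfOrder (x * y) s := by
  obtain ⟨u, hu, rfl⟩ := isMonicOfOrder_iff_exists.1 hx
  exact isMonicOfOrder_iff_exists.2 ⟨u * y, by rw [map_mul, hu, hy, mul_one], mul_assoc _ _ _⟩

end IsMonicOfOrder

end Monic

section Reduction

variable {K : Type*} [Field K]

lemma exists_isMonicOfOrder {W : Submodule K K⟦X⟧} {s : ℕ}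
    (hW : ∃ h ∈ W, h.order = (s : ℕ∞)) : ∃ h ∈ W, IsMonicOfOrder h s := by
  obtain ⟨h, hh, ho⟩ := hW
  rw [PowerSeries.order_eq_nat] at ho
  refine ⟨(PowerSeries.coeff s h)⁻¹ • h, W.smul_mem _ hh, fun r hr => ?_, ?_⟩
  · simp [ho.2 r hr]
  · simp [ho.1]

lemma exists_reduced {W : Submodule K K⟦X⟧} {Ω : Set ℕ}
    (hW : ∀ s ∈ Ω, ∃ h ∈ W, h.order = (s : ℕ∞)) {s : ℕ} (hs : s ∈ Ω) (b : ℕ) :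
    ∃ h ∈ W, IsMonicOfOrder h s ∧ ∀ u ∈ Ω, s < u → u < b → PowerSeries.coeff u h = 0 := by
  induction b with
  | zero =>
    obtain ⟨h, hh, hm⟩ := exists_isMonicOfOrder (hW s hs)
    exact ⟨h, hh, hm, fun u _ _ hu => absurd hu (Nat.not_lt_zero _)⟩
  | succ b ih =>
    obtain ⟨h, hh, hm, hz⟩ := ih
    by_cases hb : b ∈ Ω ∧ s < b
    · obtain ⟨y, hy, hym⟩ := exists_isMonicOfOrder (hW b hb.1)
      refine ⟨h - PowerSeries.coeff b h • y, W.sub_mem hh (W.smul_mem _ hy), ⟨fun r hr => ?_, ?_⟩,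
        fun u hu hsu hub => ?_⟩
      · simp [hm.1 r hr, hym.1 r (hr.trans hb.2)]
      · simp [hm.2, hym.1 s hb.2]
      · rcases Nat.lt_succ_iff_lt_or_eq.1 hub with hub | rfl
        · simp [hz u hu hsu hub, hym.1 u hub]
        · simp [hym.2]
    · refine ⟨h, hh, hm, fun u hu hsu hub => ?_⟩
      rcases Nat.lt_succ_iff_lt_or_eq.1 hub with hub | rfl
      · exact hz u hu hsu hub
      · exact absurd ⟨hu, hsu⟩ hb

lemma exists_mem_span_coeff_eq {ι : Type*} {W : Submodule K K⟦X⟧} {A : Set ι} {κ : ι → ℕ}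
    {x : ι → K⟦X⟧} {b q : ℕ} (hxW : ∀ i ∈ A, x i ∈ W) (hx : ∀ i ∈ A, IsMonicOfOrder (x i) (κ i))
    (hW : ∀ h ∈ W, ∀ s < b, h.order = (s : ℕ∞) → ∃ i ∈ A, κ i = s) {h : K⟦X⟧} (hh : h ∈ W)
    (hq : ∀ r < q, PowerSeries.coeff r h = 0) :
    ∃ y ∈ Submodule.span K (x '' {i ∈ A | q ≤ κ i}),
      ∀ r < b, PowerSeries.coeff r h = PowerSeries.coeff r y := by
  have hspan : Submodule.span K (x '' {i ∈ A | q ≤ κ i}) ≤ W :=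
    Submodule.span_le.2 (Set.image_subset_iff.2 fun i hi => hxW i hi.1)
  suffices ∀ t, q ≤ t → ∃ y ∈ Submodule.span K (x '' {i ∈ A | q ≤ κ i}),
      ∀ r < t, r < b → PowerSeries.coeff r (h - y) = 0 by
    obtain ⟨y, hy, hr⟩ := this (max q b) (le_max_left q b)
    exact ⟨y, hy, fun r hrb =>
      sub_eq_zero.1 (by rw [← map_sub, hr r (lt_max_of_lt_right hrb) hrb])⟩
  intro t hqt
  induction t, hqt using Nat.le_induction with
  | base => exact ⟨0, Submodule.zero_mem _, fun r hr _ => by rw [sub_zero, hq r hr]⟩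
  | succ t hqt ih =>
    obtain ⟨y, hy, hzero⟩ := ih
    by_cases ht : t < b → PowerSeries.coeff t (h - y) = 0
    · exact ⟨y, hy, fun r hr hrb => (Nat.lt_succ_iff_lt_or_eq.1 hr).elim (hzero r · hrb)
        (by rintro rfl; exact ht hrb)⟩
    push Not at ht
    obtain ⟨htb, ht⟩ := ht
    obtain ⟨i, hi, rfl⟩ := hW _ (W.sub_mem hh (hspan hy)) t htb
      (PowerSeries.order_eq_nat.2 ⟨ht, fun r hr => hzero r hr (hr.trans htb)⟩)
    refine ⟨y + PowerSeries.coeff (κ i) (h - y) • x i, Submodule.add_mem _ hy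
      (Submodule.smul_mem _ _ (Submodule.subset_span ⟨i, ⟨hi, hqt⟩, rfl⟩)), fun r hr hrb => ?_⟩
    rw [← sub_sub, map_sub, map_smul, smul_eq_mul, sub_eq_zero]
    rcases Nat.lt_succ_iff_lt_or_eq.1 hr with hr | rfl
    · rw [hzero r hr hrb, (hx i hi).1 r hr, mul_zero]
    · rw [(hx i hi).2, mul_one]

/-- The ring of quotients `x = h / f ^ e` with `h` a combination of products of `e` elements of
`V`: the image in `K⟦X⟧` of the coordinate ring of the affine chart where the section `f` does not
vanish. -/
def quotientRing (V : Submodule K K⟦X⟧) {f : K⟦X⟧} (hf : f ∈ V) : Subalgebra K K⟦X⟧ where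
  carrier := {x | ∃ e, x * f ^ e ∈ V ^ e}
  mul_mem' := by
    rintro x y ⟨e, hx⟩ ⟨e', hy⟩
    refine ⟨e + e', ?_⟩
    rw [pow_add, pow_add, mul_mul_mul_comm]
    exact Submodule.mul_mem_mul hx hy
  add_mem' := by
    rintro x y ⟨e, hx⟩ ⟨e', hy⟩
    refine ⟨e + e', ?_⟩
    have hx' := Submodule.mul_mem_mul hx (Submodule.pow_mem_pow V hf e')
    have hy' := Submodule.mul_mem_mul hy (Submodule.pow_mem_pow V hf e)
    rw [← pow_add, mul_assoc, ← pow_add] at hx' hy'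
    rw [add_comm e' e] at hy'
    rw [add_mul]
    exact Submodule.add_mem _ hx' hy'
  algebraMap_mem' r := ⟨0, by
    rw [pow_zero f, mul_one, pow_zero V]
    exact Submodule.algebraMap_mem r⟩

lemma exists_mem_quotientRing_order_eq_iff {V : Submodule K K⟦X⟧} {f : K⟦X⟧} (hf : f ∈ V)
    (hu : IsUnit f) (s : ℕ) :
    (∃ x ∈ quotientRing V hf, x.order = (s : ℕ∞)) ↔ ∃ e, ∃ h ∈ V ^ e, h.order = (s : ℕ∞) := by
  constructor
  · rintro ⟨x, ⟨e, hx⟩, hs⟩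
    exact ⟨e, _, hx, by rw [mul_comm, order_unit_mul (hu.pow e), hs]⟩
  · rintro ⟨e, h, hh, hs⟩
    obtain ⟨g, hg⟩ := (hu.pow e).exists_left_inv
    have hgh : g * h * f ^ e = h := by rw [mul_right_comm, hg, one_mul]
    exact ⟨g * h, ⟨e, hgh.symm ▸ hh⟩, by
      rw [order_unit_mul (IsUnit.of_mul_eq_one _ hg), hs]⟩

lemma mul_mem_quotientRing {V : Submodule K K⟦X⟧} {f g h : K⟦X⟧} (hf : f ∈ V) (hh : h ∈ V)
    (hg : g * f = 1) : h * g ∈ quotientRing V hf :=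
  ⟨1, by rwa [pow_one, pow_one, mul_assoc, hg, mul_one]⟩

end Reduction

section NormalForm

variable {n : ℕ} {S : AddSubmonoid ℕ} {k : Fin (n + 1) → ℕ} {q : ℕ}

variable (S k q) in
/-- The orders of the generators of the local ring that are used in a normal form: an affine
coordinate of order `k i.succ` for every `i : Fin n`, and an element of order `s` for every missing
generator `s < q` of `S`. -/
def generatorOrder : Fin n ⊕ generatorsBelow S k q → ℕ :=
  Sum.elim (fun i => k i.succ) Subtype.val

lemma exists_sum_mul_generatorOrder_eq (hk0 : k 0 = 0) (hq : q ≤ conductor S) {u : ℕ} (hu : u ∈ S)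
    (huq : u < q) : ∃ w : Fin n ⊕ generatorsBelow S k q → ℕ,
      ∑ i, w i * generatorOrder S k q i = u := by
  induction u using Nat.strong_induction_on with
  | _ u ih =>
  have hsingle : ∀ i, generatorOrder S k q i = u →
      ∃ w : Fin n ⊕ generatorsBelow S k q → ℕ, ∑ i, w i * generatorOrder S k q i = u :=
    fun i hi => ⟨Pi.single i 1, by simp only [Pi.single_apply, ite_mul, one_mul, zero_mul,
      Finset.sum_ite_eq', Finset.mem_univ, if_true, hi]⟩
  by_cases hu0 : u = 0
  · exact ⟨0, by simp [hu0]⟩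
  by_cases hgen : IsMinimalGenerator S u
  · by_cases huk : u ∈ Set.range k
    · obtain ⟨l, rfl⟩ := huk
      obtain ⟨i, rfl⟩ := Fin.exists_succ_eq.2 (fun h : l = 0 => hu0 (h ▸ hk0))
      exact hsingle (.inl i) rfl
    · exact hsingle (.inr ⟨u, Finset.mem_filter.2 ⟨Finset.mem_filter.2
        ⟨Finset.mem_range.2 (huq.trans_le hq), hgen, huk⟩, huq⟩⟩) rfl
  · simp only [IsMinimalGenerator, not_and, not_forall, not_or] at hgen
    obtain ⟨a, ha, b, hb, hab, ha0, hb0⟩ := hgen hu hu0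
    obtain ⟨w, hw⟩ := ih a (by omega) ha (by omega)
    obtain ⟨w', hw'⟩ := ih b (by omega) hb (by omega)
    refine ⟨w + w', ?_⟩
    simp only [Pi.add_apply, add_mul, Finset.sum_add_distrib, hw, hw', hab]

variable (S k q) in
/-- The exponents of a chosen monomial of order `u` in the generators, for `u ∈ S` less than `q`;
for other `u` the value is arbitrary. -/
noncomputable def exponents (u : ℕ) : Fin n ⊕ generatorsBelow S k q → ℕ :=
  Classical.epsilon fun w => ∑ i, w i * generatorOrder S k q i = u

lemma sum_exponents_mul_generatorOrder (hk0 : k 0 = 0) (hq : q ≤ conductor S) {u : ℕ} (hu : u ∈ S)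
    (huq : u < q) : ∑ i, exponents S k q u i * generatorOrder S k q i = u :=
  Classical.epsilon_spec (exists_sum_mul_generatorOrder_eq hk0 hq hu huq)

/-- A normal form of a morphism of degree `d` at a point, relative to a cutoff `q`: a reduced
echelon basis `form` of the space of sections; generators `gen` of the local ring, of which the
first `n` are the affine coordinates `form i.succ / form 0` and those for the missing generators of
`S` are reduced modulo the elements of larger order; and the coefficients of the expansions of the
syzygies of the affine coordinates in the monomials with exponents `exponents S k q u`. -/
structure NormalForm (R : Type*) [CommRing R] (d q : ℕ) (S : AddSubmonoid ℕ)
    (k : Fin (n + 1) → ℕ) (I : ℕ → Finset (Fin n → ℕ)) (ref : ℕ → Fin n → ℕ) where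
  form : Fin (n + 1) → R⟦X⟧
  gen : Fin n ⊕ generatorsBelow S k q → R⟦X⟧
  syzygyCoeff : (Σ _ : ℕ, Fin n → ℕ) → ℕ → R
  isMonicOfOrder_form : ∀ l, IsMonicOfOrder (form l) (k l)
  coeff_form_of_ne : ∀ l l', l ≠ l' → PowerSeries.coeff (k l') (form l) = 0
  coeff_form_of_lt : ∀ l r, d < r → PowerSeries.coeff r (form l) = 0
  form_succ : ∀ i, form (Fin.succ i) = form 0 * gen (.inl i)
  isMonicOfOrder_gen : ∀ i, IsMonicOfOrder (gen i) (generatorOrder S k q i)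
  coeff_gen_inr : ∀ s, ∀ u ∈ S, s.1 < u → u < q → PowerSeries.coeff u (gen (.inr s)) = 0
  coeff_syzygy : ∀ σ ∈ syzygies S I ref, ∀ r < q,
    PowerSeries.coeff r (∏ i, gen (.inl i) ^ σ.2 i - ∏ i, gen (.inl i) ^ ref σ.1 i) =
      ∑ u ∈ (Finset.Ioo σ.1 q).filter (· ∈ S),
        syzygyCoeff σ u * PowerSeries.coeff r (∏ i, gen i ^ exponents S k q u i)

variable {K : Type*} [Field K] {d : ℕ} {I : ℕ → Finset (Fin n → ℕ)} {ref : ℕ → Fin n → ℕ}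

lemma exists_echelonBasis (hk : Function.Injective k) {V : Submodule K K⟦X⟧}
    (hV : ∀ s : ℕ, s ∈ Set.range k ↔ ∃ h ∈ V, h.order = (s : ℕ∞))
    (hd : ∀ h ∈ V, ∀ r, d < r → PowerSeries.coeff r h = 0) :
    ∃ form : Fin (n + 1) → K⟦X⟧, (∀ l, form l ∈ V) ∧ (∀ l, IsMonicOfOrder (form l) (k l)) ∧
      (∀ l l', l ≠ l' → PowerSeries.coeff (k l') (form l) = 0) ∧
      V ≤ Submodule.span K (Set.range form) := by
  choose form hmem hmonic hreduced using fun l => exists_reduced (W := V) (Ω := Set.range k)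
    (fun s hs => (hV s).1 hs) (Set.mem_range_self l) (d + 1)
  refine ⟨form, hmem, hmonic, fun l l' hl => ?_, fun h hh => ?_⟩
  · rcases lt_or_gt_of_ne (hk.ne hl) with hlt | hgt
    · by_cases hd' : d < k l'
      · exact hd _ (hmem l) _ hd'
      · exact hreduced l (k l') ⟨l', rfl⟩ hlt (Nat.lt_succ_of_le (not_lt.1 hd'))
    · exact (hmonic l).1 _ hgt
  · obtain ⟨y, hy, hyh⟩ := exists_mem_span_coeff_eq (A := Set.univ) (κ := k) (b := d + 1) (q := 0)
      (fun l _ => hmem l) (fun l _ => hmonic l)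
      (fun x hx s _ hs => by simpa using (hV s).2 ⟨x, hx, hs⟩) hh (by simp)
    have hyform : y ∈ Submodule.span K (Set.range form) := by simpa using hy
    have hyV : y ∈ V := Submodule.span_le.2 (Set.range_subset_iff.2 hmem) hyform
    convert hyform using 1
    ext r
    by_cases hr : r < d + 1
    · exact hyh r hr
    · rw [hd h hh r (by omega), hd y hyV r (by omega)]

lemma exists_syzygyCoeff {A : Subalgebra K K⟦X⟧}
    (hA : ∀ s : ℕ, (∃ x ∈ A, x.order = (s : ℕ∞)) → s ∈ S) (hk0 : k 0 = 0) (hq : q ≤ conductor S)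
    {gen : Fin n ⊕ generatorsBelow S k q → K⟦X⟧} (hgen : ∀ i, gen i ∈ A)
    (hmonic : ∀ i, IsMonicOfOrder (gen i) (generatorOrder S k q i)) {v v' : Fin n → ℕ} {s : ℕ}
    (hv : value k v = s) (hv' : value k v' = s) :
    ∃ c : ℕ → K, ∀ r < q,
      PowerSeries.coeff r (∏ i, gen (.inl i) ^ v i - ∏ i, gen (.inl i) ^ v' i) =
        ∑ u ∈ (Finset.Ioo s q).filter (· ∈ S),
          c u * PowerSeries.coeff r (∏ i, gen i ^ exponents S k q u i) := by
  have hcoord : ∀ v : Fin n → ℕ, IsMonicOfOrder (∏ i, gen (.inl i) ^ v i) (value k v) :=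
    IsMonicOfOrder.prod_pow fun i => hmonic (.inl i)
  have hmem : ∀ v : Fin n → ℕ, ∏ i, gen (.inl i) ^ v i ∈ A := fun v =>
    A.prod_mem fun i _ => A.pow_mem (hgen _) _
  have hlow : ∀ r < s + 1,
      PowerSeries.coeff r (∏ i, gen (.inl i) ^ v i - ∏ i, gen (.inl i) ^ v' i) = 0 := by
    intro r hr
    have h := hcoord v
    have h' := hcoord v'
    rw [hv] at h
    rw [hv'] at h'
    rcases Nat.lt_succ_iff_lt_or_eq.1 hr with hr | rfl
    · rw [map_sub, h.1 r hr, h'.1 r hr, sub_zero]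
    · rw [map_sub, h.2, h'.2, sub_self]
  obtain ⟨y, hy, hyr⟩ := exists_mem_span_coeff_eq (W := A.toSubmodule)
    (A := {u | u ∈ S ∧ u < q}) (κ := id) (x := fun u => ∏ i, gen i ^ exponents S k q u i)
    (fun u _ => A.prod_mem fun i _ => A.pow_mem (hgen i) _)
    (fun u hu => by
      simpa [sum_exponents_mul_generatorOrder hk0 hq hu.1 hu.2] using
        IsMonicOfOrder.prod_pow hmonic (exponents S k q u))
    (fun x hx u hu hxu => ⟨u, ⟨hA u ⟨x, hx, hxu⟩, hu⟩, rfl⟩)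
    (A.sub_mem (hmem v) (hmem v')) hlow
  have hset : {u | u ∈ {u | u ∈ S ∧ u < q} ∧ s + 1 ≤ id u} =
      ((Finset.Ioo s q).filter (· ∈ S) : Finset ℕ) := by
    ext u
    simp only [Set.mem_ofPred_eq, id_eq, Finset.coe_filter, Finset.mem_Ioo]
    exact ⟨fun h => ⟨⟨h.2, h.1.2⟩, h.1.1⟩, fun h => ⟨⟨h.2, h.1.2⟩, h.1.1⟩⟩
  rw [hset, Submodule.mem_span_image_finset_iff_exists_fun'] at hy
  obtain ⟨c, rfl⟩ := hy
  exact ⟨c, fun r hr => (hyr r hr).trans (by simp only [map_sum, map_smul, smul_eq_mul])⟩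

lemma exists_normalForm_of_submodule (hk0 : k 0 = 0) (hk : Function.Injective k)
    (hq : q ≤ conductor S) (hI : Unlinked k I) (href : ∀ s, (I s).Nonempty → ref s ∈ I s)
    {V : Submodule K K⟦X⟧}
    (hval : ∀ s : ℕ, s ∈ S ↔ ∃ e, ∃ h ∈ V ^ e, h.order = (s : ℕ∞))
    (hvan : ∀ s : ℕ, s ∈ Set.range k ↔ ∃ h ∈ V, h.order = (s : ℕ∞))
    (hd : ∀ h ∈ V, ∀ r, d < r → PowerSeries.coeff r h = 0) :
    ∃ N : NormalForm K d q S k I ref, V ≤ Submodule.span K (Set.range N.form) := by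
  obtain ⟨form, hformV, hform, hechelon, hspan⟩ := exists_echelonBasis hk hvan hd
  have hform0 : PowerSeries.constantCoeff (form 0) = 1 :=
    IsMonicOfOrder.constantCoeff_eq_one (by have := hform 0; rwa [hk0] at this)
  have hunit : IsUnit (form 0) :=
    PowerSeries.isUnit_iff_constantCoeff.2 (by rw [hform0]; exact isUnit_one)
  obtain ⟨g, hg⟩ := hunit.exists_left_inv
  have hg0 : PowerSeries.constantCoeff g = 1 := by
    simpa [hform0] using congrArg PowerSeries.constantCoeff hg
  have hA : ∀ s : ℕ, s ∈ S ↔ ∃ x ∈ quotientRing V (hformV 0), x.order = (s : ℕ∞) := fun s =>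
    (hval s).trans (exists_mem_quotientRing_order_eq_iff (hformV 0) hunit s).symm
  choose h hhA hh hreduced using fun s : generatorsBelow S k q =>
    exists_reduced (W := (quotientRing V (hformV 0)).toSubmodule) (Ω := S)
      (fun s hs => (hA s).1 hs)
      (Finset.mem_filter.1 (Finset.mem_filter.1 s.2).1).2.1.1 q
  set gen : Fin n ⊕ generatorsBelow S k q → K⟦X⟧ := Sum.elim (fun i => form i.succ * g) h
  have hgenA : ∀ i, gen i ∈ quotientRing V (hformV 0) :=
    Sum.rec (fun i => mul_mem_quotientRing _ (hformV i.succ) hg) hhA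
  have hgen : ∀ i, IsMonicOfOrder (gen i) (generatorOrder S k q i) :=
    Sum.rec (fun i => (hform i.succ).mul_of_constantCoeff_eq_one hg0) hh
  have hsyz : ∀ σ ∈ syzygies S I ref, _ := fun σ hσ => exists_syzygyCoeff
    (fun s hs => (hA s).2 hs) hk0 hq hgenA hgen (hI.value_eq (mem_syzygies.1 hσ).2.2)
    (hI.value_eq (ref_mem href hσ))
  choose! c hc using hsyz
  exact ⟨{
    form := form
    gen := gen
    syzygyCoeff := c
    isMonicOfOrder_form := hform
    coeff_form_of_ne := hechelon
    coeff_form_of_lt := fun l r hr => hd _ (hformV l) r hr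
    form_succ := fun i => by
      rw [show gen (.inl i) = form i.succ * g from rfl, mul_left_comm, mul_comm (form 0), hg,
        mul_one]
    isMonicOfOrder_gen := hgen
    coeff_gen_inr := hreduced
    coeff_syzygy := hc }, hspan⟩

lemma coeff_chartSection_of_lt (ε : Bool) (a : Fin (n + 1) × Fin (d + 1) → ℂ) (p : ℂ)
    (i : Fin (n + 1)) {r : ℕ} (hr : d < r) : PowerSeries.coeff r (chartSection ε a p i) = 0 := by
  have hpow : ∀ j, j < r → PowerSeries.coeff r ((PowerSeries.C p + PowerSeries.X) ^ j) = 0 := by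
    intro j hj
    have hpoly : (PowerSeries.C p + PowerSeries.X : ℂ⟦X⟧) ^ j =
        ((Polynomial.X + Polynomial.C p : Polynomial ℂ) ^ j : Polynomial ℂ) := by
      push_cast
      rw [add_comm]
    rw [hpoly, Polynomial.coeff_coe]
    exact Polynomial.coeff_eq_zero_of_natDegree_lt (by rwa [Polynomial.natDegree_pow_X_add_C])
  rw [chartSection, map_sum]
  exact Finset.sum_eq_zero fun j _ => by
    rw [PowerSeries.coeff_C_mul, hpow j (by omega), mul_zero]

lemma coeff_of_mem_span_range_chartSection {ε : Bool} {a : Fin (n + 1) × Fin (d + 1) → ℂ} {p : ℂ}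
    {h : ℂ⟦X⟧} (hh : h ∈ Submodule.span ℂ (Set.range (chartSection ε a p))) {r : ℕ} (hr : d < r) :
    PowerSeries.coeff r h = 0 := by
  have hle : Submodule.span ℂ (Set.range (chartSection ε a p)) ≤
      LinearMap.ker (PowerSeries.coeff (R := ℂ) r) :=
    Submodule.span_le.2 (Set.range_subset_iff.2 fun i => coeff_chartSection_of_lt ε a p i hr)
  exact hle hh

lemma exists_chart_of_mem_stratum {a : Fin (n + 1) × Fin (d + 1) → ℂ} (ha : a ∈ stratum d S k) :
    ∃ ε p, (∀ s : ℕ, s ∈ S ↔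
        ∃ e, ∃ h ∈ Submodule.span ℂ (Set.range (chartSection ε a p)) ^ e, h.order = (s : ℕ∞)) ∧
      ∀ s : ℕ, s ∈ Set.range k ↔
        ∃ h ∈ Submodule.span ℂ (Set.range (chartSection ε a p)), h.order = (s : ℕ∞) := by
  obtain ⟨⟨-, hbase⟩, -, P, hP, hval, hvan, -⟩ := ha
  obtain ⟨ε, p, Q, hQ, hspan⟩ := exists_chart a hP
  refine ⟨ε, p, fun s => ?_, fun s => ?_⟩
  · rw [← hspan, ← mem_valueSet_iff hQ (hbase P hP), hval, SetLike.mem_coe]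
  · rw [← hspan, ← mem_vanishingOrders_iff hQ, hvan]

lemma mem_and_le_of_mem_stratum {a : Fin (n + 1) × Fin (d + 1) → ℂ} (ha : a ∈ stratum d S k)
    (l : Fin (n + 1)) : k l ∈ S ∧ k l ≤ d := by
  obtain ⟨ε, p, hval, hvan⟩ := exists_chart_of_mem_stratum ha
  obtain ⟨h, hh, hord⟩ := (hvan (k l)).1 ⟨l, rfl⟩
  refine ⟨(hval _).2 ⟨1, h, by rwa [pow_one], hord⟩, not_lt.1 fun hlt => ?_⟩
  exact (PowerSeries.order_eq_nat.1 hord).1 (coeff_of_mem_span_range_chartSection hh hlt)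

theorem exists_normalForm (hk0 : k 0 = 0) (hk : Function.Injective k) (hq : q ≤ conductor S)
    (hI : Unlinked k I) (href : ∀ s, (I s).Nonempty → ref s ∈ I s)
    {a : Fin (n + 1) × Fin (d + 1) → ℂ} (ha : a ∈ stratum d S k) :
    ∃ (ε : Bool) (p : ℂ) (g : Fin (n + 1) → Fin (n + 1) → ℂ) (N : NormalForm ℂ d q S k I ref),
      ∀ i, chartSection ε a p i = ∑ l, PowerSeries.C (g i l) * N.form l := by
  obtain ⟨ε, p, hval, hvan⟩ := exists_chart_of_mem_stratum ha
  obtain ⟨N, hN⟩ := exists_normalForm_of_submodule hk0 hk hq hI href hval hvan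
    fun h hh r hr => coeff_of_mem_span_range_chartSection hh hr
  choose g hg using fun i => (Submodule.mem_span_range_iff_exists_fun ℂ).1
    (hN (Submodule.subset_span ⟨i, rfl⟩))
  exact ⟨ε, p, g, N, fun i => by simp only [← hg, PowerSeries.smul_eq_C_mul]⟩

end NormalForm

/-! ### Elimination by syzygies -/

section Units

variable {F R : Type*} [CommRing F] [CommRing R] [Algebra F R] {A : Subalgebra F R}

/-- Power series with constant coefficient `1` whose coefficients below `t` are already known to lie
in `A`; modulo `A`, the coefficient of order `t` is additive on products of such series. -/
def IsUnitBelow (A : Subalgebra F R) (t : ℕ) (x : R⟦X⟧) : Prop :=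
  PowerSeries.constantCoeff x = 1 ∧ ∀ r < t, PowerSeries.coeff r x ∈ A

namespace IsUnitBelow

variable {t : ℕ} {x y : R⟦X⟧}

lemma mono {t' : ℕ} (hx : IsUnitBelow A t x) (h : t' ≤ t) : IsUnitBelow A t' x :=
  ⟨hx.1, fun r hr => hx.2 r (hr.trans_le h)⟩

lemma one : IsUnitBelow A t 1 :=
  ⟨map_one _, fun r _ => by
    rw [PowerSeries.coeff_one]
    split_ifs
    exacts [A.one_mem, A.zero_mem]⟩

lemma mul (hx : IsUnitBelow A t x) (hy : IsUnitBelow A t y) : IsUnitBelow A t (x * y) := by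
  refine ⟨by rw [map_mul, hx.1, hy.1, one_mul], fun r hr => ?_⟩
  rw [PowerSeries.coeff_mul]
  refine A.sum_mem fun m hm => ?_
  rw [Finset.HasAntidiagonal.mem_antidiagonal] at hm
  exact A.mul_mem (hx.2 _ (by omega)) (hy.2 _ (by omega))

lemma coeff_mul_sub_mem (ht : t ≠ 0) (hx : IsUnitBelow A t x) (hy : IsUnitBelow A t y) :
    PowerSeries.coeff t (x * y) - (PowerSeries.coeff t x + PowerSeries.coeff t y) ∈ A := by
  have hzero : ∀ z : R⟦X⟧, IsUnitBelow A t z → PowerSeries.coeff 0 (z - 1) = 0 := fun z hz => by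
    rw [PowerSeries.coeff_zero_eq_constantCoeff_apply, map_sub, hz.1, map_one, sub_self]
  have hone : PowerSeries.coeff t (1 : R⟦X⟧) = 0 := by rw [PowerSeries.coeff_one, if_neg ht]
  have hsub : ∀ z : R⟦X⟧, IsUnitBelow A t z → ∀ r < t, PowerSeries.coeff r (z - 1) ∈ A :=
    fun z hz r hr => by
      rw [map_sub]
      exact A.sub_mem (hz.2 r hr) (one.2 r hr)
  have hmul : PowerSeries.coeff t ((x - 1) * (y - 1)) ∈ A := by
    rw [PowerSeries.coeff_mul]
    refine A.sum_mem fun m hm => ?_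
    rw [Finset.HasAntidiagonal.mem_antidiagonal] at hm
    by_cases h1 : m.1 = 0
    · rw [h1, hzero x hx, zero_mul]
      exact A.zero_mem
    by_cases h2 : m.2 = 0
    · rw [h2, hzero y hy, mul_zero]
      exact A.zero_mem
    exact A.mul_mem (hsub x hx _ (by omega)) (hsub y hy _ (by omega))
  convert hmul using 1
  rw [sub_one_mul, mul_sub_one, map_sub, map_sub, map_sub, hone]
  ring

lemma pow (hx : IsUnitBelow A t x) (m : ℕ) : IsUnitBelow A t (x ^ m) := by
  induction m with
  | zero => rw [pow_zero]; exact one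
  | succ m ih => rw [pow_succ]; exact ih.mul hx

lemma coeff_pow_sub_mem (ht : t ≠ 0) (hx : IsUnitBelow A t x) (m : ℕ) :
    PowerSeries.coeff t (x ^ m) - m • PowerSeries.coeff t x ∈ A := by
  induction m with
  | zero => simp [PowerSeries.coeff_one, ht, A.zero_mem]
  | succ m ih =>
    rw [pow_succ, succ_nsmul]
    convert A.add_mem ((hx.pow m).coeff_mul_sub_mem ht hx) ih using 1
    abel

variable {ι : Type*} {T : Finset ι} {z : ι → R⟦X⟧} {m : ι → ℕ}

lemma prod_pow (hz : ∀ i ∈ T, m i ≠ 0 → IsUnitBelow A t (z i)) :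
    IsUnitBelow A t (∏ i ∈ T, z i ^ m i) := by
  refine Finset.prod_induction _ _ (fun _ _ => mul) one fun i hi => ?_
  by_cases hm : m i = 0
  · rw [hm, pow_zero]
    exact one
  · exact (hz i hi hm).pow _

lemma coeff_prod_pow_sub_mem (ht : t ≠ 0) (m : ι → ℕ) (hz : ∀ i ∈ T, IsUnitBelow A t (z i)) :
    PowerSeries.coeff t (∏ i ∈ T, z i ^ m i) - ∑ i ∈ T, m i • PowerSeries.coeff t (z i) ∈ A := by
  induction T using Finset.induction_on with
  | empty => simp [PowerSeries.coeff_one, ht, A.zero_mem]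
  | insert i T hi ih =>
    rw [Finset.prod_insert hi, Finset.sum_insert hi]
    have hzT := fun j hj => hz j (Finset.mem_insert_of_mem hj)
    have hzi := hz i (Finset.mem_insert_self _ _)
    convert A.add_mem (A.add_mem ((hzi.pow (m i)).coeff_mul_sub_mem ht
      (prod_pow (m := m) fun j hj _ => hzT j hj)) (hzi.coeff_pow_sub_mem ht (m i))) (ih hzT) using 1
    abel

end IsUnitBelow

lemma coeff_X_pow_mul_add (s r : ℕ) (x : R⟦X⟧) :
    PowerSeries.coeff (s + r) (PowerSeries.X ^ s * x) = PowerSeries.coeff r x := by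
  rw [add_comm, PowerSeries.coeff_X_pow_mul]

end Units

section Pivots

variable {K M ι : Type*} [CommRing K] [AddCommGroup M] [Module K M] [Fintype ι]

lemma mem_of_pivots {V : Submodule K (ι → K)} {W : Submodule K M} {E : Finset ι} {x : ι → M}
    (hE : ∀ i ∈ E, ∃ v ∈ V, v i = 1 ∧ ∀ i' ∈ E, i' ≠ i → v i' = 0)
    (hV : ∀ v ∈ V, ∑ i, v i • x i ∈ W) (hx : ∀ i ∉ E, x i ∈ W) (i : ι) : x i ∈ W := by
  by_cases hi : i ∈ E
  · obtain ⟨v, hv, hvi, hv0⟩ := hE i hi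
    have hsum := hV v hv
    rw [← Finset.add_sum_erase _ _ (Finset.mem_univ i), hvi, one_smul] at hsum
    refine (W.add_mem_iff_left (W.sum_mem fun i' hi' => ?_)).1 hsum
    by_cases hi'E : i' ∈ E
    · rw [hv0 i' hi'E (Finset.ne_of_mem_erase hi'), zero_smul]
      exact W.zero_mem
    · exact W.smul_mem _ (hx i' hi'E)
  · exact hx i hi

end Pivots

section Elimination

variable {n : ℕ} {S : AddSubmonoid ℕ} {k : Fin (n + 1) → ℕ} {d q : ℕ}
  {I : ℕ → Finset (Fin n → ℕ)} {ref : ℕ → Fin n → ℕ}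

lemma sum_smul_mem_of_mem_activeSpan {M : Type*} [AddCommGroup M] [Module ℚ M] {W : Submodule ℚ M}
    {x : Fin n → M} {j : ℕ}
    (hx : ∀ σ ∈ syzygies S I ref, σ.1 + j ∉ S → σ.1 + j < q →
      ∑ i, syzygyVector ref σ i • x i ∈ W) {v : Fin n → ℚ} (hv : v ∈ activeSpan S I ref q j) :
    ∑ i, v i • x i ∈ W := by
  have hle : activeSpan S I ref q j ≤ W.comap (Fintype.linearCombination ℚ x) := by
    refine Submodule.span_le.2 fun v hv => ?_
    obtain ⟨σ, hσ, ⟨hσS, hσq⟩, rfl⟩ := mem_activeVectors.1 (Finset.mem_coe.1 hv)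
    exact hx σ hσ hσS hσq
  exact hle hv

namespace NormalForm

variable {R : Type*} [CommRing R]

/-- The power series `u` with constant coefficient `1` such that the generator with index `i` is
`X ^ s * u`, where `s` is its order. -/
noncomputable def unitPart (N : NormalForm R d q S k I ref) (i : Fin n ⊕ generatorsBelow S k q) :
    R⟦X⟧ :=
  PowerSeries.mk fun r => PowerSeries.coeff (generatorOrder S k q i + r) (N.gen i)

variable (N : NormalForm R d q S k I ref)

lemma gen_eq (i : Fin n ⊕ generatorsBelow S k q) :
    N.gen i = PowerSeries.X ^ generatorOrder S k q i * N.unitPart i := by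
  obtain ⟨u, -, hu⟩ := isMonicOfOrder_iff_exists.1 (N.isMonicOfOrder_gen i)
  have : N.unitPart i = u := by
    ext r
    rw [unitPart, PowerSeries.coeff_mk, hu, coeff_X_pow_mul_add]
  rw [this, hu]

lemma constantCoeff_unitPart (i : Fin n ⊕ generatorsBelow S k q) :
    PowerSeries.constantCoeff (N.unitPart i) = 1 := by
  rw [← PowerSeries.coeff_zero_eq_constantCoeff_apply, unitPart, PowerSeries.coeff_mk]
  exact (N.isMonicOfOrder_gen i).2

lemma form_succ_eq (i : Fin n) :
    N.form i.succ = PowerSeries.X ^ k i.succ * (N.form 0 * N.unitPart (.inl i)) := by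
  rw [N.form_succ, N.gen_eq, mul_left_comm]
  rfl

lemma prod_gen_inl_pow (v : Fin n → ℕ) : ∏ i, N.gen (.inl i) ^ v i =
    PowerSeries.X ^ value k v * ∏ i, N.unitPart (.inl i) ^ v i := by
  simp only [N.gen_eq]
  exact prod_X_pow_mul_pow _ _ _

lemma isMonicOfOrder_prod_gen_pow_exponents (hk0 : k 0 = 0) (hq : q ≤ conductor S) {t : ℕ}
    (ht : t ∈ S) (htq : t < q) : IsMonicOfOrder (∏ i, N.gen i ^ exponents S k q t i) t := by
  have h := IsMonicOfOrder.prod_pow N.isMonicOfOrder_gen (exponents S k q t)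
  rwa [sum_exponents_mul_generatorOrder hk0 hq ht htq] at h

variable [Algebra ℚ R] {A : Subalgebra ℚ R} {N} {j : ℕ}

lemma coeff_prod_gen_inl_pow_sub_mem (hj : j ≠ 0)
    (hu : ∀ i, IsUnitBelow A j (N.unitPart (.inl i))) (v : Fin n → ℕ) :
    PowerSeries.coeff (value k v + j) (∏ i, N.gen (.inl i) ^ v i) -
      ∑ i, v i • PowerSeries.coeff j (N.unitPart (.inl i)) ∈ A := by
  rw [N.prod_gen_inl_pow, coeff_X_pow_mul_add]
  exact IsUnitBelow.coeff_prod_pow_sub_mem hj v fun i _ => hu i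

lemma coeff_prod_gen_pow_exponents_mem (hk0 : k 0 = 0) (hq : q ≤ conductor S)
    (hu : ∀ i, IsUnitBelow A j (N.unitPart (.inl i)))
    (hgen : ∀ s, ∀ r < q, PowerSeries.coeff r (N.gen (.inr s)) ∈ A) {t r : ℕ} (ht : t ∈ S)
    (htr : t ≤ r) (hrt : r < t + j) (hrq : r < q) :
    PowerSeries.coeff r (∏ i, N.gen i ^ exponents S k q t i) ∈ A := by
  have hord := sum_exponents_mul_generatorOrder hk0 hq ht (htr.trans_lt hrq)
  have hprod : ∏ i, N.gen i ^ exponents S k q t i =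
      PowerSeries.X ^ t * ∏ i, N.unitPart i ^ exponents S k q t i := by
    rw [funext N.gen_eq, prod_X_pow_mul_pow, hord]
  obtain ⟨r, rfl⟩ := Nat.exists_eq_add_of_le htr
  rw [hprod, coeff_X_pow_mul_add]
  refine (IsUnitBelow.prod_pow (A := A) (t := r + 1) fun i _ hi => ?_).2 r (Nat.lt_succ_self r)
  cases i with
  | inl i => exact (hu i).mono (by omega)
  | inr s =>
    have hs : s.1 ≤ t := by
      rw [← hord]
      exact (Nat.le_mul_of_pos_left _ (Nat.pos_of_ne_zero hi)).trans (Finset.single_le_sum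
        (f := fun i => exponents S k q t i * generatorOrder S k q i) (fun _ _ => Nat.zero_le _)
        (Finset.mem_univ (Sum.inr s)))
    refine ⟨N.constantCoeff_unitPart _, fun r' hr' => ?_⟩
    rw [unitPart, PowerSeries.coeff_mk]
    exact hgen s _ (by change s.1 + r' < q; omega)

lemma sum_syzygyCoeff_mul_sub_mem (hk0 : k 0 = 0) (hq : q ≤ conductor S) (hj : j ≠ 0)
    (hu : ∀ i, IsUnitBelow A j (N.unitPart (.inl i)))
    (hgen : ∀ s, ∀ r < q, PowerSeries.coeff r (N.gen (.inr s)) ∈ A)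
    {σ : Σ _ : ℕ, Fin n → ℕ} (hσq : σ.1 + j < q)
    (hc : ∀ u ∈ S, σ.1 < u → u < σ.1 + j → N.syzygyCoeff σ u ∈ A) :
    ∑ u ∈ (Finset.Ioo σ.1 q).filter (· ∈ S), N.syzygyCoeff σ u *
        PowerSeries.coeff (σ.1 + j) (∏ i, N.gen i ^ exponents S k q u i) -
      (if σ.1 + j ∈ S then N.syzygyCoeff σ (σ.1 + j) else 0) ∈ A := by
  have hite : (if σ.1 + j ∈ S then N.syzygyCoeff σ (σ.1 + j) else 0) =
      ∑ u ∈ (Finset.Ioo σ.1 q).filter (· ∈ S), if u = σ.1 + j then N.syzygyCoeff σ u else 0 := by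
    rw [Finset.sum_ite_eq']
    exact if_congr (by simp [hσq, Nat.pos_of_ne_zero hj]) rfl rfl
  rw [hite, ← Finset.sum_sub_distrib]
  refine A.sum_mem fun u hu' => ?_
  simp only [Finset.mem_filter, Finset.mem_Ioo] at hu'
  obtain ⟨⟨hσu, huq⟩, huS⟩ := hu'
  have hmonic := N.isMonicOfOrder_prod_gen_pow_exponents hk0 hq huS huq
  rcases lt_trichotomy u (σ.1 + j) with h | rfl | h
  · rw [if_neg h.ne, sub_zero]
    exact A.mul_mem (hc u huS hσu h)
      (coeff_prod_gen_pow_exponents_mem hk0 hq hu hgen huS h.le (by omega) hσq)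
  · rw [if_pos rfl, hmonic.2, mul_one, sub_self]
    exact A.zero_mem
  · rw [if_neg h.ne', hmonic.1 _ h, mul_zero, sub_zero]
    exact A.zero_mem

lemma sum_syzygyVector_smul_sub_mem (hk0 : k 0 = 0) (hq : q ≤ conductor S) (hI : Unlinked k I)
    (href : ∀ s, (I s).Nonempty → ref s ∈ I s) (hj : j ≠ 0)
    (hu : ∀ i, IsUnitBelow A j (N.unitPart (.inl i)))
    (hgen : ∀ s, ∀ r < q, PowerSeries.coeff r (N.gen (.inr s)) ∈ A)
    {σ : Σ _ : ℕ, Fin n → ℕ} (hσ : σ ∈ syzygies S I ref) (hσq : σ.1 + j < q)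
    (hc : ∀ u ∈ S, σ.1 < u → u < σ.1 + j → N.syzygyCoeff σ u ∈ A) :
    ∑ i, syzygyVector ref σ i • PowerSeries.coeff j (N.unitPart (.inl i)) -
      (if σ.1 + j ∈ S then N.syzygyCoeff σ (σ.1 + j) else 0) ∈ A := by
  have hσv := coeff_prod_gen_inl_pow_sub_mem hj hu σ.2
  have href' := coeff_prod_gen_inl_pow_sub_mem hj hu (ref σ.1)
  rw [hI.value_eq (mem_syzygies.1 hσ).2.2] at hσv
  rw [hI.value_eq (ref_mem href hσ)] at href'
  have hsum := sum_syzygyCoeff_mul_sub_mem hk0 hq hj hu hgen hσq hc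
  rw [← N.coeff_syzygy σ hσ _ hσq, map_sub] at hsum
  convert A.sub_mem (A.add_mem hsum href') hσv using 1
  simp only [syzygyVector, diff, sub_smul, Nat.cast_smul_eq_nsmul, Finset.sum_sub_distrib]
  abel

lemma coeff_unitPart_inl_mem_of_coeff_form_mem (hk0 : k 0 = 0) (hj : j ≠ 0)
    (hu : ∀ i, IsUnitBelow A j (N.unitPart (.inl i)))
    (hform0 : ∀ r, PowerSeries.coeff r (N.form 0) ∈ A) {i : Fin n}
    (hi : PowerSeries.coeff (k i.succ + j) (N.form i.succ) ∈ A) :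
    PowerSeries.coeff j (N.unitPart (.inl i)) ∈ A := by
  have hform : IsUnitBelow A j (N.form 0) :=
    ⟨IsMonicOfOrder.constantCoeff_eq_one (by have := N.isMonicOfOrder_form 0; rwa [hk0] at this),
      fun r _ => hform0 r⟩
  rw [N.form_succ_eq, coeff_X_pow_mul_add] at hi
  convert A.sub_mem (A.sub_mem hi (hform.coeff_mul_sub_mem hj (hu i))) (hform0 j) using 1
  abel

lemma coeff_unitPart_inl_mem (hk0 : k 0 = 0) (hq : q ≤ conductor S) (hI : Unlinked k I)
    (href : ∀ s, (I s).Nonempty → ref s ∈ I s) {E : ℕ → Finset (Fin n)}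
    (hE : ∀ j, ∀ i ∈ E j, ∃ v ∈ activeSpan S I ref q j, v i = 1 ∧ ∀ i' ∈ E j, i' ≠ i → v i' = 0)
    (hform0 : ∀ r, PowerSeries.coeff r (N.form 0) ∈ A)
    (hform : ∀ i j, j ≠ 0 → i ∉ E j → PowerSeries.coeff (k i.succ + j) (N.form i.succ) ∈ A)
    (hgen : ∀ s, ∀ r < q, PowerSeries.coeff r (N.gen (.inr s)) ∈ A) (j : ℕ) :
    (∀ i, PowerSeries.coeff j (N.unitPart (.inl i)) ∈ A) ∧
      (j ≠ 0 → ∀ σ ∈ syzygies S I ref, σ.1 + j ∈ S → σ.1 + j < q →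
        N.syzygyCoeff σ (σ.1 + j) ∈ A) := by
  induction j using Nat.strong_induction_on with
  | _ j ih =>
  by_cases hj : j = 0
  · subst hj
    refine ⟨fun i => ?_, fun h => absurd rfl h⟩
    rw [PowerSeries.coeff_zero_eq_constantCoeff_apply, N.constantCoeff_unitPart]
    exact A.one_mem
  have hu : ∀ i, IsUnitBelow A j (N.unitPart (.inl i)) := fun i =>
    ⟨N.constantCoeff_unitPart _, fun r hr => (ih r hr).1 i⟩
  have hsyz : ∀ σ ∈ syzygies S I ref, σ.1 + j < q →
      ∑ i, syzygyVector ref σ i • PowerSeries.coeff j (N.unitPart (.inl i)) -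
        (if σ.1 + j ∈ S then N.syzygyCoeff σ (σ.1 + j) else 0) ∈ A := by
    refine fun σ hσ hσq => sum_syzygyVector_smul_sub_mem hk0 hq hI href hj hu hgen hσ hσq ?_
    intro u huS hσu hu'
    obtain ⟨j', rfl⟩ := Nat.exists_eq_add_of_le hσu.le
    exact (ih j' (by omega)).2 (by omega) σ hσ huS (by omega)
  have hcoord : ∀ i, PowerSeries.coeff j (N.unitPart (.inl i)) ∈ A := by
    refine mem_of_pivots (W := Subalgebra.toSubmodule A) (hE j)
      (fun v hv => sum_smul_mem_of_mem_activeSpan (fun σ hσ hσS hσq => ?_) hv)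
      fun i hi => coeff_unitPart_inl_mem_of_coeff_form_mem hk0 hj hu hform0 (hform i j hj hi)
    simpa [hσS] using hsyz σ hσ hσq
  refine ⟨hcoord, fun _ σ hσ hσS hσq => ?_⟩
  have hsum : ∑ i, syzygyVector ref σ i • PowerSeries.coeff j (N.unitPart (.inl i)) ∈ A :=
    A.sum_mem fun i _ => A.smul_mem (hcoord i) _
  have h := A.sub_mem hsum (hsyz σ hσ hσq)
  rwa [if_pos hσS, sub_sub_cancel] at h

theorem coeff_form_mem (hk0 : k 0 = 0) (hq : q ≤ conductor S) (hI : Unlinked k I)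
    (href : ∀ s, (I s).Nonempty → ref s ∈ I s) {E : ℕ → Finset (Fin n)}
    (hE : ∀ j, ∀ i ∈ E j, ∃ v ∈ activeSpan S I ref q j, v i = 1 ∧ ∀ i' ∈ E j, i' ≠ i → v i' = 0)
    (hform0 : ∀ r, PowerSeries.coeff r (N.form 0) ∈ A)
    (hform : ∀ i j, j ≠ 0 → i ∉ E j → PowerSeries.coeff (k i.succ + j) (N.form i.succ) ∈ A)
    (hgen : ∀ s, ∀ r < q, PowerSeries.coeff r (N.gen (.inr s)) ∈ A) (l : Fin (n + 1)) (r : ℕ) :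
    PowerSeries.coeff r (N.form l) ∈ A := by
  refine Fin.cases (hform0 r) (fun i => ?_) l
  by_cases hr : k i.succ ≤ r
  · obtain ⟨r, rfl⟩ := Nat.exists_eq_add_of_le hr
    rw [N.form_succ_eq, coeff_X_pow_mul_add, PowerSeries.coeff_mul]
    exact A.sum_mem fun m _ => A.mul_mem (hform0 _)
      ((coeff_unitPart_inl_mem hk0 hq hI href hE hform0 hform hgen _).1 i)
  · rw [(N.isMonicOfOrder_form i.succ).1 r (not_le.1 hr)]
    exact A.zero_mem

end NormalForm

end Elimination

section ActiveSpan

variable {n : ℕ} {S : AddSubmonoid ℕ} {k : Fin (n + 1) → ℕ} {I : ℕ → Finset (Fin n → ℕ)}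
  {ref : ℕ → Fin n → ℕ} {q j : ℕ} {v : Fin n → ℚ}

lemma sum_mul_eq_zero_of_mem_activeSpan (hI : Unlinked k I)
    (href : ∀ s, (I s).Nonempty → ref s ∈ I s) (hv : v ∈ activeSpan S I ref q j) :
    ∑ i, v i * (k i.succ : ℚ) = 0 := by
  refine (Submodule.mem_bot ℚ).1 (sum_smul_mem_of_mem_activeSpan (W := ⊥)
    (x := fun i => (k i.succ : ℚ)) (fun σ hσ _ _ => (Submodule.mem_bot ℚ).2 ?_) hv)
  have hvalue : (value k σ.2 : ℚ) = value k (ref σ.1) := by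
    rw [hI.value_eq (mem_syzygies.1 hσ).2.2, hI.value_eq (ref_mem href hσ)]
  simp only [value, Nat.cast_sum, Nat.cast_mul] at hvalue
  simp only [syzygyVector, diff, smul_eq_mul, sub_mul, Finset.sum_sub_distrib, hvalue, sub_self]

lemma value_add_mem_of_apply_ne_zero (hkS : ∀ l, k l ∈ S) {v : Fin n → ℕ} {i : Fin n}
    (hv : v i ≠ 0) (hi : k i.succ + j ∈ S) : value k v + j ∈ S := by
  rw [← single_add_sub_single (Nat.one_le_iff_ne_zero.2 hv), value_add, value_single, one_mul,
    add_right_comm]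
  exact S.add_mem hi (S.sum_mem fun l _ => S.nsmul_mem (hkS _) _)

lemma apply_eq_zero_of_mem_activeSpan (hkS : ∀ l, k l ∈ S) (hI : Unlinked k I)
    (href : ∀ s, (I s).Nonempty → ref s ∈ I s) (hv : v ∈ activeSpan S I ref q j) {i : Fin n}
    (hi : k i.succ + j ∈ S) : v i = 0 := by
  have hle : activeSpan S I ref q j ≤ LinearMap.ker (LinearMap.proj i : (Fin n → ℚ) →ₗ[ℚ] ℚ) := by
    refine Submodule.span_le.2 fun v hv => ?_
    obtain ⟨σ, hσ, ⟨hgap, -⟩, rfl⟩ := mem_activeVectors.1 (Finset.mem_coe.1 hv)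
    have hzero : ∀ w ∈ I σ.1, w i = 0 := fun w hw => by
      by_contra hwi
      exact hgap (hI.value_eq hw ▸ value_add_mem_of_apply_ne_zero hkS hwi hi)
    simp [syzygyVector, diff, hzero _ (mem_syzygies.1 hσ).2.2, hzero _ (ref_mem href hσ)]
  exact hle hv

lemma exists_activeSpan_pivots (hS : {r : ℕ | r ∉ S}.Finite) (hk0 : k 0 = 0)
    (hk : Function.Injective k) (hkS : ∀ l, k l ∈ S) {d : ℕ} (hd : 2 * genus S - 2 ≤ d)
    (hI : Unlinked k I) (href : ∀ s, (I s).Nonempty → ref s ∈ I s) (q j : ℕ) :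
    ∃ E : Finset (Fin n), (∀ i ∈ E, k i.succ + j ∉ S ∧ k i.succ + j ≤ d) ∧
      E.card = Module.finrank ℚ (activeSpan S I ref q j) ∧
      ∀ i ∈ E, ∃ v ∈ activeSpan S I ref q j, v i = 1 ∧ ∀ i' ∈ E, i' ≠ i → v i' = 0 := by
  have hdetermined : ∀ v ∈ activeSpan S I ref q j,
      (∀ i ∈ Finset.univ.filter (fun i : Fin n => k i.succ + j ∉ S ∧ k i.succ + j ≤ d), v i = 0) →
      v = 0 := by
    intro v hv hU
    -- As gaps are less than `2 g`, a coordinate of `v` that is not known to vanish has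
    -- `k i.succ + j = 2 g - 1`, which leaves at most one index.
    have hgap : ∀ i, v i ≠ 0 → k i.succ + j = 2 * genus S - 1 := by
      intro i hi
      have hiS : k i.succ + j ∉ S :=
        fun h => hi (apply_eq_zero_of_mem_activeSpan hkS hI href hv h)
      have hid : d < k i.succ + j :=
        not_le.1 fun h => hi (hU i (Finset.mem_filter.2 ⟨Finset.mem_univ i, hiS, h⟩))
      have := lt_two_mul_genus hS hiS
      omega
    ext i
    by_contra hi
    have hsum := sum_mul_eq_zero_of_mem_activeSpan hI href hv
    rw [Finset.sum_eq_single_of_mem i (Finset.mem_univ i)] at hsum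
    · refine hi ((mul_eq_zero.1 hsum).resolve_right fun h => Fin.succ_ne_zero i (hk ?_))
      rw [hk0]
      exact_mod_cast h
    · intro i' _ hi'
      by_contra h
      have heq := (hgap i' (left_ne_zero_of_mul h)).trans (hgap i hi).symm
      exact hi' (Fin.succ_injective _ (hk (Nat.add_right_cancel heq)))
  obtain ⟨E, hEU, hcard, hE⟩ := exists_pivots hdetermined
  exact ⟨E, fun i hi => (Finset.mem_filter.1 (hEU hi)).2, hcard, hE⟩

end ActiveSpan

/-! ### Families of normal forms -/

section Families

variable {Z F L : Type*} [CommRing F] [CommRing L] [Algebra F L]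

/-- The ring homomorphism from families of power series induced by a homomorphism on families of
coefficients. -/
noncomputable def familyMap (π : (Z → F) →ₐ[F] L) : (Z → F⟦X⟧) →+* L⟦X⟧ where
  toFun h := PowerSeries.mk fun r => π fun z => PowerSeries.coeff r (h z)
  map_one' := by
    ext r
    simp only [PowerSeries.coeff_mk, Pi.one_apply, PowerSeries.coeff_one]
    split_ifs
    exacts [map_one π, map_zero π]
  map_zero' := by
    ext
    exact map_zero π
  map_add' h h' := by
    ext r
    simp only [PowerSeries.coeff_mk, map_add, Pi.add_apply]
    exact map_add π _ _
  map_mul' h h' := by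
    ext r
    simp only [PowerSeries.coeff_mk, Pi.mul_apply, PowerSeries.coeff_mul, ← map_mul, ← map_sum]
    congr 1
    ext z
    simp only [Finset.sum_apply, Pi.mul_apply]

variable (π : (Z → F) →ₐ[F] L)

@[simp]
lemma coeff_familyMap (h : Z → F⟦X⟧) (r : ℕ) :
    PowerSeries.coeff r (familyMap π h) = π fun z => PowerSeries.coeff r (h z) := by
  simp only [familyMap, RingHom.coe_mk, MonoidHom.coe_mk, OneHom.coe_mk, PowerSeries.coeff_mk]

lemma familyMap_C (b : Z → F) :
    familyMap π (fun z => PowerSeries.C (b z)) = PowerSeries.C (π b) := by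
  ext r
  simp only [coeff_familyMap, PowerSeries.coeff_C]
  split_ifs
  exacts [rfl, map_zero π]

lemma familyMap_X : familyMap π (fun _ => PowerSeries.X) = PowerSeries.X := by
  ext r
  simp only [coeff_familyMap, PowerSeries.coeff_X]
  split_ifs
  exacts [map_one π, map_zero π]

lemma familyMap_prod_pow {ι : Type*} [Fintype ι] (x : Z → ι → F⟦X⟧) (m : ι → ℕ) :
    familyMap π (fun z => ∏ i, x z i ^ m i) = ∏ i, familyMap π (fun z => x z i) ^ m i := by
  simp only [← map_pow, ← map_prod]
  congr 1
  ext z : 1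
  simp only [Finset.prod_apply, Pi.pow_apply]

lemma coeff_familyMap_eq_zero {h : Z → F⟦X⟧} {r : ℕ} (hh : ∀ z, PowerSeries.coeff r (h z) = 0) :
    PowerSeries.coeff r (familyMap π h) = 0 := by
  rw [coeff_familyMap, funext hh]
  exact map_zero π

lemma IsMonicOfOrder.familyMap {h : Z → F⟦X⟧} {s : ℕ} (hh : ∀ z, IsMonicOfOrder (h z) s) :
    IsMonicOfOrder (familyMap π h) s := by
  refine ⟨fun r hr => coeff_familyMap_eq_zero π fun z => (hh z).1 r hr, ?_⟩
  rw [coeff_familyMap, funext fun z => (hh z).2]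
  exact map_one π

variable {n d q : ℕ} {S : AddSubmonoid ℕ} {k : Fin (n + 1) → ℕ}
  {I : ℕ → Finset (Fin n → ℕ)} {ref : ℕ → Fin n → ℕ}

/-- The normal form over `L` obtained from a family of normal forms by applying `π` to each family
of corresponding coefficients. -/
noncomputable def NormalForm.familyMap (N : Z → NormalForm F d q S k I ref) :
    NormalForm L d q S k I ref where
  form l := Severi.familyMap π fun z => (N z).form l
  gen i := Severi.familyMap π fun z => (N z).gen i
  syzygyCoeff σ u := π fun z => (N z).syzygyCoeff σ u
  isMonicOfOrder_form l := .familyMap π fun z => (N z).isMonicOfOrder_form l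
  coeff_form_of_ne l l' h := coeff_familyMap_eq_zero π fun z => (N z).coeff_form_of_ne l l' h
  coeff_form_of_lt l r h := coeff_familyMap_eq_zero π fun z => (N z).coeff_form_of_lt l r h
  form_succ i := by
    rw [← map_mul]
    congr 1
    exact funext fun z => (N z).form_succ i
  isMonicOfOrder_gen i := .familyMap π fun z => (N z).isMonicOfOrder_gen i
  coeff_gen_inr s u hu hsu huq :=
    coeff_familyMap_eq_zero π fun z => (N z).coeff_gen_inr s u hu hsu huq
  coeff_syzygy σ hσ r hr := by
    simp only [← familyMap_prod_pow, ← map_sub, coeff_familyMap, ← map_mul, ← map_sum]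
    congr 1
    ext z
    simpa only [Finset.sum_apply, Pi.mul_apply, Pi.sub_apply] using (N z).coeff_syzygy σ hσ r hr

end Families

section Translate

variable {F R : Type*} [CommRing F] [CommRing R] [Algebra F R] {A : Subalgebra F R}

lemma mem_of_coeff_translate_mem {d : ℕ} (b : Fin (d + 1) → R) {p : R} (hp : p ∈ A)
    (h : ∀ r, PowerSeries.coeff r (∑ j : Fin (d + 1), PowerSeries.C (b j) *
      (PowerSeries.C p + PowerSeries.X) ^ (j : ℕ)) ∈ A) (j : Fin (d + 1)) : b j ∈ A := by
  set P : Polynomial R := ∑ j : Fin (d + 1), Polynomial.C (b j) *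
    (Polynomial.C p + Polynomial.X) ^ (j : ℕ) with hP
  have hcoe : (P : R⟦X⟧) = ∑ j : Fin (d + 1), PowerSeries.C (b j) *
      (PowerSeries.C p + PowerSeries.X) ^ (j : ℕ) := by
    rw [hP, ← Polynomial.coeToPowerSeries.ringHom_apply, map_sum]
    simp
  obtain ⟨Q, hQ⟩ : P ∈ Polynomial.lifts A.val.toRingHom := by
    rw [Polynomial.lifts_iff_coeff_lifts]
    intro r
    rw [← Polynomial.coeff_coe, hcoe]
    exact ⟨⟨_, h r⟩, rfl⟩
  have hcomp : (Q.comp (Polynomial.X - Polynomial.C ⟨p, hp⟩)).map A.val.toRingHom =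
      ∑ j : Fin (d + 1), Polynomial.C (b j) * Polynomial.X ^ (j : ℕ) := by
    have hQ' : Q.map A.val.toRingHom = P := hQ
    rw [Polynomial.map_comp, hQ', hP, Polynomial.sum_comp]
    simp
  have hcoeff : Polynomial.coeff (∑ j : Fin (d + 1), Polynomial.C (b j) * Polynomial.X ^ (j : ℕ))
      (j : ℕ) = b j := by
    rw [Polynomial.finsetSum_coeff, Finset.sum_eq_single_of_mem j (Finset.mem_univ j)]
    · simp
    · intro j' _ hj'
      simp [Polynomial.coeff_X_pow, Fin.val_inj, Ne.symm hj']
  rw [← hcoeff, ← hcomp, Polynomial.coeff_map]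
  exact Subtype.property _

end Translate

/-! ### The dimension count -/

section Count

variable {n d q : ℕ} {S : AddSubmonoid ℕ} {k : Fin (n + 1) → ℕ}

/-- The positions `(l, r)` of the coefficients of a reduced echelon basis of series of degree at
most `d`, with pivots `k`, that the echelon form leaves free. -/
noncomputable def freePositions (d : ℕ) (k : Fin (n + 1) → ℕ) : Finset (Σ _ : Fin (n + 1), ℕ) :=
  Finset.univ.sigma fun l => (Finset.Ioc (k l) d).filter (· ∉ Set.range k)

/-- The positions of the coefficients of a normal form that its syzygies determine, when the
distance-`j` conditions are solved for the coordinates in `E j`. -/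
noncomputable def pivotPositions (k : Fin (n + 1) → ℕ) (q : ℕ) (E : ℕ → Finset (Fin n)) :
    Finset (Σ _ : Fin (n + 1), ℕ) :=
  ((Finset.Icc 1 q).sigma E).image fun x => ⟨x.2.succ, k x.2.succ + x.1⟩

/-- The positions `(s, r)` of the coefficients below `q` of the missing generators of a normal form
that it leaves free. -/
noncomputable def generatorPositions (S : AddSubmonoid ℕ) (k : Fin (n + 1) → ℕ) (q : ℕ) :
    Finset (Σ _ : generatorsBelow S k q, ℕ) :=
  Finset.univ.sigma fun s => (Finset.range q).filter fun r => s.1 < r ∧ r ∉ S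

lemma mem_freePositions {l : Fin (n + 1)} {r : ℕ} :
    ⟨l, r⟩ ∈ freePositions d k ↔ (k l < r ∧ r ≤ d) ∧ r ∉ Set.range k := by
  simp only [freePositions, Finset.mem_sigma, Finset.mem_univ, true_and, Finset.mem_filter,
    Finset.mem_Ioc]

lemma mem_pivotPositions {E : ℕ → Finset (Fin n)} {l : Fin (n + 1)} {r : ℕ} :
    ⟨l, r⟩ ∈ pivotPositions k q E ↔
      ∃ j ∈ Finset.Icc 1 q, ∃ i ∈ E j, i.succ = l ∧ k i.succ + j = r := by
  simp only [pivotPositions, Finset.mem_image, Finset.mem_sigma, Sigma.exists, Sigma.mk.injEq,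
    heq_eq_eq, and_assoc, exists_and_left]

lemma card_generatorPositions :
    (generatorPositions S k q).card = ∑ s ∈ generatorsBelow S k q, rhoBelow S q s := by
  rw [generatorPositions, Finset.card_sigma]
  exact Finset.sum_coe_sort (generatorsBelow S k q) (rhoBelow S q)

lemma card_pivotPositions (E : ℕ → Finset (Fin n)) :
    (pivotPositions k q E).card = ∑ j ∈ Finset.Icc 1 q, (E j).card := by
  rw [pivotPositions, Finset.card_image_of_injective, Finset.card_sigma]
  rintro ⟨j, i⟩ ⟨j', i'⟩ h
  obtain ⟨hi, hj⟩ := Sigma.mk.inj h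
  obtain rfl : i = i' := Fin.succ_injective _ hi
  obtain rfl : j = j' := Nat.add_left_cancel (eq_of_heq hj)
  rfl

lemma pivotPositions_subset (hkS : ∀ l, k l ∈ S) {E : ℕ → Finset (Fin n)}
    (hE : ∀ j, ∀ i ∈ E j, k i.succ + j ∉ S ∧ k i.succ + j ≤ d) :
    pivotPositions k q E ⊆ freePositions d k := by
  rintro ⟨l, r⟩ hlr
  obtain ⟨j, hj, i, hi, rfl, rfl⟩ := mem_pivotPositions.1 hlr
  obtain ⟨hgap, hle⟩ := hE j i hi
  refine mem_freePositions.2 ⟨⟨?_, hle⟩, fun ⟨l, hl⟩ => hgap (hl ▸ hkS l)⟩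
  exact Nat.lt_add_of_pos_right (Finset.mem_Icc.1 hj).1

lemma card_freePositions (hk : StrictMono k) (hkd : ∀ l, k l ≤ d) :
    ((freePositions d k).card : ℤ) = ∑ l : Fin (n + 1), ((d : ℤ) - k l - (n - (l : ℕ))) := by
  rw [freePositions, Finset.card_sigma, Nat.cast_sum]
  refine Finset.sum_congr rfl fun l _ => ?_
  have hpivots : ((Finset.Ioc (k l) d).filter (· ∈ Set.range k)) = (Finset.Ioi l).image k := by
    ext r
    simp only [Finset.mem_filter, Finset.mem_Ioc, Finset.mem_image, Finset.mem_Ioi]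
    constructor
    · rintro ⟨⟨h, -⟩, l', rfl⟩
      exact ⟨l', hk.lt_iff_lt.1 h, rfl⟩
    · rintro ⟨l', h, rfl⟩
      exact ⟨⟨hk h, hkd l'⟩, l', rfl⟩
  have hsplit := Finset.card_filter_add_card_filter_not (s := Finset.Ioc (k l) d)
    (· ∈ Set.range k)
  rw [hpivots, Finset.card_image_of_injective _ hk.injective, Fin.card_Ioi, Nat.card_Ioc] at hsplit
  have := hkd l
  have := l.2
  omega

lemma card_freePositions_eq (hk0 : k 0 = 0) (hk : StrictMono k) (hkd : ∀ l, k l ≤ d) :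
    ((freePositions d k).card : ℤ) =
      (n + 1) * (d - n) - ∑ i : Fin n, ((k i.succ : ℤ) - ((i : ℤ) + 1)) := by
  have hterm (i : Fin n) : (d : ℤ) - k i.succ - (n - (i.succ : ℕ)) =
      (d - n) - ((k i.succ : ℤ) - ((i : ℤ) + 1)) := by
    rw [Fin.val_succ]
    push_cast
    ring
  rw [card_freePositions hk hkd, Fin.sum_univ_succ, hk0, Finset.sum_congr rfl fun i _ => hterm i,
    Finset.sum_sub_distrib, Finset.sum_const, Finset.card_univ, Fintype.card_fin, nsmul_eq_mul,
    Fin.val_zero]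
  push_cast
  ring

end Count

section Chart

variable {n d q : ℕ} {S : AddSubmonoid ℕ} {k : Fin (n + 1) → ℕ} {I : ℕ → Finset (Fin n → ℕ)}
  {ref : ℕ → Fin n → ℕ}

namespace NormalForm

variable {R : Type*} [CommRing R]

lemma coeff_form_of_notMem_freePositions (N : NormalForm R d q S k I ref) {l : Fin (n + 1)} {r : ℕ}
    (h : ⟨l, r⟩ ∉ freePositions d k) :
    PowerSeries.coeff r (N.form l) = if r = k l then 1 else 0 := by
  split_ifs with hr
  · rw [hr, (N.isMonicOfOrder_form l).2]
  rcases lt_or_gt_of_ne hr with hlt | hgt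
  · exact (N.isMonicOfOrder_form l).1 r hlt
  by_cases hd : d < r
  · exact N.coeff_form_of_lt l r hd
  obtain ⟨l', rfl⟩ : r ∈ Set.range k := by
    by_contra hrange
    exact h (mem_freePositions.2 ⟨⟨hgt, not_lt.1 hd⟩, hrange⟩)
  exact N.coeff_form_of_ne l l' fun hl => hr (congrArg k hl.symm)

lemma coeff_gen_of_notMem_generatorPositions (N : NormalForm R d q S k I ref)
    {s : generatorsBelow S k q} {r : ℕ} (hr : r < q) (h : ⟨s, r⟩ ∉ generatorPositions S k q) :
    PowerSeries.coeff r (N.gen (.inr s)) = if r = s then 1 else 0 := by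
  split_ifs with hrs
  · rw [hrs]
    exact (N.isMonicOfOrder_gen (.inr s)).2
  rcases lt_or_gt_of_ne hrs with hlt | hgt
  · exact (N.isMonicOfOrder_gen (.inr s)).1 r hlt
  refine N.coeff_gen_inr s r ?_ hgt hr
  by_contra hrS
  exact h (Finset.mem_sigma.2 ⟨Finset.mem_univ s,
    Finset.mem_filter.2 ⟨Finset.mem_range.2 hr, hgt, hrS⟩⟩)

theorem coeff_form_mem_of_positions (N : NormalForm R d q S k I ref) [Algebra ℚ R]
    {A : Subalgebra ℚ R} (hk0 : k 0 = 0) (hq : q ≤ conductor S) (hI : Unlinked k I)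
    (href : ∀ s, (I s).Nonempty → ref s ∈ I s) {E : ℕ → Finset (Fin n)}
    (hE : ∀ j, ∀ i ∈ E j, ∃ v ∈ activeSpan S I ref q j, v i = 1 ∧ ∀ i' ∈ E j, i' ≠ i → v i' = 0)
    (hform : ∀ x ∈ freePositions d k \ pivotPositions k q E,
      PowerSeries.coeff x.2 (N.form x.1) ∈ A)
    (hgen : ∀ x ∈ generatorPositions S k q, PowerSeries.coeff x.2 (N.gen (.inr x.1)) ∈ A)
    (l : Fin (n + 1)) (r : ℕ) : PowerSeries.coeff r (N.form l) ∈ A := by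
  have hmem (l r) (hlr : ⟨l, r⟩ ∉ pivotPositions k q E) : PowerSeries.coeff r (N.form l) ∈ A := by
    by_cases hfree : ⟨l, r⟩ ∈ freePositions d k
    · exact hform ⟨l, r⟩ (Finset.mem_sdiff.2 ⟨hfree, hlr⟩)
    · rw [N.coeff_form_of_notMem_freePositions hfree]
      split_ifs
      exacts [A.one_mem, A.zero_mem]
  refine coeff_form_mem hk0 hq hI href hE (fun r => hmem 0 r fun h => ?_)
    (fun i j _ hi => hmem _ _ fun h => ?_) (fun s r hr => ?_) l r
  · obtain ⟨_, _, i, _, hi, _⟩ := mem_pivotPositions.1 h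
    exact Fin.succ_ne_zero i hi
  · obtain ⟨j', _, i', hi', hii', hjj'⟩ := mem_pivotPositions.1 h
    obtain rfl := Fin.succ_injective _ hii'
    obtain rfl := Nat.add_left_cancel hjj'
    exact hi hi'
  · by_cases hpos : ⟨s, r⟩ ∈ generatorPositions S k q
    · exact hgen ⟨s, r⟩ hpos
    · rw [N.coeff_gen_of_notMem_generatorPositions hr hpos]
      split_ifs
      exacts [A.one_mem, A.zero_mem]

end NormalForm

lemma mem_of_chartSection_eq {Z : Set (Fin (n + 1) × Fin (d + 1) → ℂ)} {L : Type*} [CommRing L]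
    [Algebra ℂ L] (π : (Z → ℂ) →ₐ[ℂ] L) {A : Subalgebra ℂ L} (ε : Bool) {p : Z → ℂ}
    {g : Z → Fin (n + 1) → Fin (n + 1) → ℂ} {G : Z → Fin (n + 1) → ℂ⟦X⟧}
    (hchart : ∀ (a : Z) i, chartSection ε a.1 (p a) i = ∑ l, PowerSeries.C (g a i l) * G a l)
    (hp : π p ∈ A) (hg : ∀ i l, π (fun a => g a i l) ∈ A)
    (hG : ∀ l r, PowerSeries.coeff r (familyMap π fun a => G a l) ∈ A)
    (x : Fin (n + 1) × Fin (d + 1)) : π (fun a => a.1 x) ∈ A := by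
  obtain ⟨i, j⟩ := x
  have hmap : ∑ j : Fin (d + 1), PowerSeries.C (π fun a => a.1 (i, chartPerm d ε j)) *
      (PowerSeries.C (π p) + PowerSeries.X) ^ (j : ℕ) =
      ∑ l, PowerSeries.C (π fun a => g a i l) * familyMap π fun a => G a l := by
    simp only [← familyMap_C, ← familyMap_X π, ← map_add, ← map_pow, ← map_mul, ← map_sum]
    congr 1
    ext a : 1
    simpa only [Finset.sum_apply, Pi.mul_apply, Pi.pow_apply, Pi.add_apply, chartSection] using
      hchart a i
  have hmem := mem_of_coeff_translate_mem (A := A)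
    (fun j => π fun a => a.1 (i, chartPerm d ε j)) hp (fun r => ?_) ((chartPerm d ε).symm j)
  · rwa [Equiv.apply_symm_apply] at hmem
  · rw [hmap, map_sum]
    refine A.sum_mem fun l _ => ?_
    rw [PowerSeries.coeff_C_mul]
    exact A.mul_mem (hg i l) (hG l r)

theorem card_le_codim_add_of_normalForm (hk0 : k 0 = 0) (hq : q ≤ conductor S) (hI : Unlinked k I)
    (href : ∀ s, (I s).Nonempty → ref s ∈ I s) {E : ℕ → Finset (Fin n)}
    (hE : ∀ j, ∀ i ∈ E j, ∃ v ∈ activeSpan S I ref q j, v i = 1 ∧ ∀ i' ∈ E j, i' ≠ i → v i' = 0)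
    (ε : Bool) {Z : Set (Fin (n + 1) × Fin (d + 1) → ℂ)}
    (hZ : ∀ a ∈ Z, ∃ (p : ℂ) (g : Fin (n + 1) → Fin (n + 1) → ℂ) (N : NormalForm ℂ d q S k I ref),
      ∀ i, chartSection ε a p i = ∑ l, PowerSeries.C (g i l) * N.form l) :
    (((n + 1) * (d + 1) : ℕ) : ℕ∞) ≤ codim Z + ((1 + (n + 1) * (n + 1) +
      (freePositions d k \ pivotPositions k q E).card + (generatorPositions S k q).card : ℕ)) := by
  have hcard : Fintype.card (Fin (n + 1) × Fin (d + 1)) = (n + 1) * (d + 1) := by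
    rw [Fintype.card_prod, Fintype.card_fin, Fintype.card_fin]
  rw [← hcard]
  refine card_le_codim_add fun L _ _ π => ?_
  have : CharZero L := charZero_of_injective_algebraMap (algebraMap ℂ L).injective
  choose p g N hchart using fun a : Z => hZ a.1 a.2
  let N' := NormalForm.familyMap π N
  let T : Finset L := {π p} ∪
    Finset.univ.image (fun x : Fin (n + 1) × Fin (n + 1) => π fun a => g a x.1 x.2) ∪
    (freePositions d k \ pivotPositions k q E).image
      (fun x => PowerSeries.coeff x.2 (N'.form x.1)) ∪
    (generatorPositions S k q).image fun x => PowerSeries.coeff x.2 (N'.gen (.inr x.1))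
  let A := (IntermediateField.adjoin ℂ (T : Set L)).toSubalgebra
  have hT {y : L} (hy : y ∈ T) : y ∈ A := IntermediateField.subset_adjoin ℂ _ hy
  have hform : ∀ l r, PowerSeries.coeff r (N'.form l) ∈ A :=
    N'.coeff_form_mem_of_positions (A := A.restrictScalars ℚ) hk0 hq hI href hE
      (fun x hx => hT <| Finset.mem_union_left _ <| Finset.mem_union_right _ <|
        Finset.mem_image_of_mem _ hx)
      (fun x hx => hT <| Finset.mem_union_right _ <| Finset.mem_image_of_mem _ hx)
  refine ⟨T, ?_, mem_of_chartSection_eq (A := A) π ε hchart (hT ?_) (fun i l => hT ?_) hform⟩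
  · rw [Set.encard_coe_eq_coe_finsetCard]
    norm_cast
    refine (Finset.card_union_le _ _).trans (Nat.add_le_add ((Finset.card_union_le _ _).trans
      (Nat.add_le_add ((Finset.card_union_le _ _).trans (Nat.add_le_add ?_ ?_)) ?_)) ?_)
    · rw [Finset.card_singleton]
    · exact Finset.card_image_le.trans (by simp)
    · exact Finset.card_image_le
    · exact Finset.card_image_le
  · simp [T]
  · simp only [T, Finset.mem_union, Finset.mem_image]
    exact .inl (.inl (.inr ⟨(i, l), Finset.mem_univ _, rfl⟩))

theorem card_le_codim_stratum_add (hk0 : k 0 = 0) (hk : Function.Injective k)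
    (hq : q ≤ conductor S) (hI : Unlinked k I) (href : ∀ s, (I s).Nonempty → ref s ∈ I s)
    {E : ℕ → Finset (Fin n)}
    (hE : ∀ j, ∀ i ∈ E j, ∃ v ∈ activeSpan S I ref q j, v i = 1 ∧ ∀ i' ∈ E j, i' ≠ i → v i' = 0) :
    (((n + 1) * (d + 1) : ℕ) : ℕ∞) ≤ codim (stratum d S k) + ((1 + (n + 1) * (n + 1) +
      (freePositions d k \ pivotPositions k q E).card + (generatorPositions S k q).card : ℕ)) := by
  let W (ε : Bool) : Set (Fin (n + 1) × Fin (d + 1) → ℂ) := {a ∈ stratum d S k |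
    ∃ (p : ℂ) (g : Fin (n + 1) → Fin (n + 1) → ℂ) (N : NormalForm ℂ d q S k I ref),
      ∀ i, chartSection ε a p i = ∑ l, PowerSeries.C (g i l) * N.form l}
  have hW : stratum d S k = W false ∪ W true := by
    ext a
    constructor
    · intro ha
      obtain ⟨ε, h⟩ := exists_normalForm hk0 hk hq hI href ha
      cases ε
      exacts [.inl ⟨ha, h⟩, .inr ⟨ha, h⟩]
    · rintro (h | h)
      exacts [h.1, h.1]
  have hbound (ε : Bool) := card_le_codim_add_of_normalForm hk0 hq hI href hE ε
    (Z := W ε) fun a ha => ha.2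
  rw [hW]
  refine le_trans ?_ (add_le_add_left (min_codim_le_codim_union _ _) _)
  rw [← min_add_add_right]
  exact le_min (hbound false) (hbound true)

theorem expectedCodim_le (hS : {r : ℕ | r ∉ S}.Finite) (hk0 : k 0 = 0) (hk : StrictMono k)
    (hd : 2 * genus S - 2 ≤ d) (hne : (stratum d S k).Nonempty) (hI : Unlinked k I)
    (href : ∀ s, (I s).Nonempty → ref s ∈ I s) {c : ℕ} (hc : codim (stratum d S k) = c) :
    expectedCodim S k I ref ≤ c := by
  obtain ⟨a, ha⟩ := hne
  have hkS (l) : k l ∈ S := (mem_and_le_of_mem_stratum ha l).1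
  have hkd (l) : k l ≤ d := (mem_and_le_of_mem_stratum ha l).2
  obtain ⟨q, hq, hcutoff⟩ := exists_cutoff hS hI
    (fun i => hk0 ▸ (hk.injective.ne (Fin.succ_ne_zero i))) href
  have hrank := sum_rhoBelow_le hS hI href q
  choose E hEd hEcard hE using
    exists_activeSpan_pivots hS hk0 hk.injective hkS hd hI href q
  have hcount := card_le_codim_stratum_add (d := d) hk0 hk.injective hq hI href hE
  rw [hc, card_generatorPositions] at hcount
  have hpivots := Finset.card_sdiff_add_card_eq_card
    (pivotPositions_subset (d := d) (q := q) hkS hEd)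
  rw [card_pivotPositions, Finset.sum_congr rfl fun j _ => hEcard j] at hpivots
  have hfree := card_freePositions_eq hk0 hk hkd
  rw [expectedCodim]
  zify at hcutoff hrank hpivots ⊢
  have hcount' : ((n : ℤ) + 1) * (d + 1) ≤ c + (1 + (n + 1) * (n + 1) +
      (freePositions d k \ pivotPositions k q E).card +
      ∑ s ∈ generatorsBelow S k q, (rhoBelow S q s : ℤ)) := mod_cast hcount
  linarith

lemma codim_ne_top {σ : Type} [Finite σ] {Z : Set (σ → ℂ)} (hZ : Z.Nonempty) : codim Z ≠ ⊤ := by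
  obtain ⟨a, ha⟩ := hZ
  refine Ideal.height_ne_top fun htop => one_ne_zero (α := ℂ) ?_
  simpa using MvPolynomial.mem_vanishingIdeal_iff.1 ((Ideal.eq_top_iff_one _).1 htop) a ha

end Chart

end Severi

theorem theorem3p8_general (n d : ℕ) (S : AddSubmonoid ℕ) (hS : {r : ℕ | r ∉ S}.Finite)
    (k : Fin (n + 1) → ℕ) (hk0 : k 0 = 0) (hk : StrictMono k) (hd : 2 * Severi.genus S - 2 ≤ d)
    (hne : (Severi.stratum d S k).Nonempty) (I : ℕ → Finset (Fin n → ℕ)) (hI : Severi.Unlinked k I)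
    (ref : ℕ → Fin n → ℕ) (href : ∀ s, (I s).Nonempty → ref s ∈ I s) :
    ∃ c : ℕ, Severi.codim (Severi.stratum d S k) = (c : ℕ∞) ∧
      Severi.expectedCodim S k I ref ≤ (c : ℤ) := by
  obtain ⟨c, hc⟩ := ENat.ne_top_iff_exists.1 (Severi.codim_ne_top hne)
  exact ⟨c, hc.symm, Severi.expectedCodim_le hS hk0 hk hd hne hI href hc.symm⟩

theorem theorem3p8 (n d : ℕ) (S : AddSubmonoid ℕ)
    (hS : {r : ℕ | r ∉ S}.Finite) (hg : 0 < Severi.genus S)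
    (k : Fin (n + 1) → ℕ) (hk0 : k 0 = 0) (hk : StrictMono k)
    (hd : max n (2 * Severi.genus S - 2) ≤ d)
    (hne : (Severi.stratum d S k).Nonempty)
    (I : ℕ → Finset (Fin n → ℕ))
    (hI : I = Severi.irreducibleDecompositions k ∨ Severi.IsSystemOfRepresentatives k I)
    (ref : ℕ → Fin n → ℕ) (href : ∀ s, (I s).Nonempty → ref s ∈ I s) :
    ∃ c : ℕ, Severi.codim (Severi.stratum d S k) = (c : ℕ∞) ∧
      Severi.expectedCodim S k I ref ≤ (c : ℤ) :=
  theorem3p8_general n d S hS k hk0 hk ((le_max_right _ _).trans hd) hne I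
    (hI.elim (fun h => h ▸ Severi.unlinked_irreducibleDecompositions) (·.unlinked)) ref href
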